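/- For an integer $k\ge 4$ and $i\in\{1,\dots,k\}$ let $C_i\subset\mathbb R^2$ be the cone of nonzero points whose polar angle lies in $[2\pi(i-1)/k,\,2\pi i/k)$. In the $\theta_k$-graph of a point set $S\subset\mathbb R^2$, each $u\in S$ chooses, for each $i$, an edge to the point $w$ of $S\cap(u+C_i)$ (if there is one) whose orthogonal projection on the axis (bisecting ray) of $u+C_i$ is nearest to $u$; two points are adjacent if at least one of them chooses the other. An edge $uw$ chosen by $u$ is mutual if $w$ also chooses $u$, in one of the cones of $w$. Let $\Phi$ be a homogeneous Poisson point process of unit intensity in the plane, let $k\ge 4$ be even, and let $B\subset\mathbb R^2$ be a Borel set with $0<|B|<\infty$. Let $p_k$ be the probability that a chosen edge of the $\theta_k$-graph of $\Phi$ is mutual, that is, $$p_k=\frac{\mathbb E\,\#\{(u,i): u\in\Phi\cap B,\ u\text{ chooses an edge in }u+C_i\text{ and this edge is mutual}\}}{\mathbb E\,\#\{(u,i): u\in\Phi\cap B,\ u\text{ chooses an edge in }u+C_i\}},$$ and let $d_k=\mathbb E\big[\sum_{u\in\Phi\cap B}\deg u\big]\big/\,\mathbb E\,\#(\Phi\cap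 B)$ be the average degree of a vertex. Then the counts in these formulas are random variables (almost surely equal to measurable functions), and $$p_k=\frac{\pi\sqrt3}{9},\qquad d_k=\Big(2-\frac{\pi\sqrt3}{9}\Big)k .$$ In particular, $p_k$ depends neither on $k$ nor on $B$. The same value $\pi\sqrt3/9$ is obtained if only the edges chosen in the $i$-th cones are counted, for any single fixed $i\in\{1,\dots,k\}$. -/

import Mathlib

open MeasureTheory ProbabilityTheory
open scoped ENNReal NNReal

noncomputable section

/-- A homogeneous Poisson point process of unit intensity in the plane (the plane is `ℂ`, with
Lebesgue measure `volume`), given as a random locally finite point set `Φ`: the number of points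
in a Borel set is a random variable, the number of points in a Borel set of finite area is Poisson
distributed with that area as its parameter, and the numbers of points in finitely many pairwise
disjoint Borel sets of finite area are mutually independent. -/
structure IsUnitPoissonProcess {Ω : Type*} [MeasurableSpace Ω] (P : Measure Ω)
    (Φ : Ω → Set ℂ) : Prop where
  locallyFinite : ∀ ω, ∀ A : Set ℂ, Bornology.IsBounded A → (Φ ω ∩ A).Finite
  measurable_count : ∀ A : Set ℂ, MeasurableSet A → Measurable fun ω => (Φ ω ∩ A).encard
  poisson_count : ∀ A : Set ℂ, MeasurableSet A → volume A ≠ ∞ → ∀ n : ℕ,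
    P {ω | (Φ ω ∩ A).encard = n} = poissonMeasure (volume A).toNNReal {n}
  indep_count : ∀ (m : ℕ) (A : Fin m → Set ℂ), (∀ j, MeasurableSet (A j)) →
    (∀ j, volume (A j) ≠ ∞) → Pairwise (fun j l => Disjoint (A j) (A l)) →
    iIndepFun (fun j ω => (Φ ω ∩ A j).encard) P

/-- The cone with apex `0` (apex excluded) of the nonzero points whose polar angle lies in
`[2πi/k, 2π(i+1)/k)`; here `i` runs through `0, …, k - 1`. -/
def thetaCone (k : ℕ) (i : Fin k) : Set ℂ :=
  {z | ∃ r > (0 : ℝ), ∃ φ ∈ Set.Ico (2 * Real.pi * (i : ℝ) / k) (2 * Real.pi * ((i : ℝ) + 1) / k),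
    z = r * Complex.exp (φ * Complex.I)}

/-- The unit vector that spans the axis (the bisecting ray) of the cone `thetaCone k i`. -/
def thetaAxis (k : ℕ) (i : Fin k) : ℂ :=
  Complex.exp (((2 * (i : ℝ) + 1) * Real.pi / k : ℝ) * Complex.I)

/-- The distance from the apex `0` to the orthogonal projection of `z` on the axis of the
cone `thetaCone k i`. -/
def thetaHeight (k : ℕ) (i : Fin k) (z : ℂ) : ℝ :=
  |inner ℝ (thetaAxis k i) z|

/-- In the `θ_k`-graph of `S`, the point `u` chooses the point `w` in its `i`-th cone: `w` is a
point of `S` in the translated cone with apex `u` whose projection on the axis is nearest to `u`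
among the points of `S` in that cone. -/
def Chooses (k : ℕ) (S : Set ℂ) (u : ℂ) (i : Fin k) (w : ℂ) : Prop :=
  u ∈ S ∧ w ∈ S ∧ w - u ∈ thetaCone k i ∧
    ∀ v ∈ S, v - u ∈ thetaCone k i → thetaHeight k i (w - u) ≤ thetaHeight k i (v - u)

/-- The `θ_k`-graph of the point set `S`: two points are adjacent if one of them chooses the
other in one of its cones. -/
def thetaGraph (k : ℕ) (S : Set ℂ) : SimpleGraph S :=
  SimpleGraph.fromRel fun u w => ∃ i : Fin k, Chooses k S u i w

/-- The number of points `u` of `S` in the window `B` that choose an edge in their `i`-th cone. -/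
def chosenCount (k : ℕ) (i : Fin k) (B S : Set ℂ) : ℝ≥0∞ :=
  ({u : ℂ | u ∈ B ∧ ∃ w, Chooses k S u i w}.encard : ℝ≥0∞)

/-- The number of points `u` of `S` in the window `B` that choose an edge `uw` in their `i`-th
cone which is mutual, that is, which `w` chooses too, in one of its own cones. -/
def mutualCount (k : ℕ) (i : Fin k) (B S : Set ℂ) : ℝ≥0∞ :=
  ({u : ℂ | u ∈ B ∧ ∃ w, Chooses k S u i w ∧ ∃ j : Fin k, Chooses k S w j u}.encard : ℝ≥0∞)

/-- The sum of the degrees, in the `θ_k`-graph of `S`, of the points of `S` in the window `B`. -/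
def degreeSum (k : ℕ) (B S : Set ℂ) : ℝ≥0∞ :=
  ∑' u : {u : S // (u : ℂ) ∈ B}, (((thetaGraph k S).neighborSet u.1).encard : ℝ≥0∞)

variable {Ω : Type*} [MeasurableSpace Ω]

/-- The probability (in the sense of Palm) that an edge chosen by a vertex of the `θ_k`-graph of
the random point set `Φ` in its `i`-th cone is mutual, computed with the window `B`: the expected
number of mutual choices by the vertices in `B`, over the expected number of all their choices. -/
def coneMutualProb (P : Measure Ω) (Φ : Ω → Set ℂ) (k : ℕ) (i : Fin k) (B : Set ℂ) : ℝ≥0∞ :=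
  (∫⁻ ω, mutualCount k i B (Φ ω) ∂P) / ∫⁻ ω, chosenCount k i B (Φ ω) ∂P

/-- The probability (in the sense of Palm) that an edge chosen by a vertex of the `θ_k`-graph of
the random point set `Φ`, in any of its `k` cones, is mutual, computed with the window `B`. -/
def mutualProb (P : Measure Ω) (Φ : Ω → Set ℂ) (k : ℕ) (B : Set ℂ) : ℝ≥0∞ :=
  (∫⁻ ω, ∑ i, mutualCount k i B (Φ ω) ∂P) / ∫⁻ ω, ∑ i, chosenCount k i B (Φ ω) ∂P

/-- The average degree of a vertex in the `θ_k`-graph of the random point set `Φ`, computed with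
the window `B`: the expected sum of the degrees of the vertices in `B`, over the expected number
of these vertices. -/
def averageDegree (P : Measure Ω) (Φ : Ω → Set ℂ) (k : ℕ) (B : Set ℂ) : ℝ≥0∞ :=
  (∫⁻ ω, degreeSum k B (Φ ω) ∂P) / ∫⁻ ω, ((Φ ω ∩ B).encard : ℝ≥0∞) ∂P

end

/-!
For even `k` the cones come in opposite pairs, so that an edge `uw` chosen by `u` in its `i`-th cone
is mutual exactly if two triangles contain no point of the process: the part of the cone of `u`
below the level of `w`, and its reflection in the midpoint of `uw`, the part of the opposite cone of
`w` above the level of `u`. In linear coordinates with respect to the two sides of the cone, let `(a, b)` be the vector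
from `u` to `w`. Up to a common factor `c` both triangles have area `(a + b)² / 2`, and they overlap
in a parallelogram of area `ab`, so that their union has area `(a + b)² - ab = a² + ab + b²`.

The bivariate Mecke formula turns expected numbers of pairs with a void region into integrals of
void probabilities. Per unit area of the window, the expected number of choices in one cone is
`∫ c exp (-c (a + b)² / 2) = ∫ (1 + t)⁻² dt = 1`, and that of mutual choices is
`∫ c exp (-c (a² + ab + b²)) = ∫ dt / (2 (1 + t + t²)) = π√3 / 9`, where `a`, `b` and `t = b / a`
run through the positive reals. The shape of the cone enters only through `c`, which cancels. The
degree of a vertex is the number of edges it chooses, plus the number of edges by which it is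
chosen, minus the number of its mutual edges.

The case of the Mecke formula that is needed, `lintegral_voidPairCount_of_isBounded`, is proved by
discretization: the points are moved to finitely many representatives of the cells of a partition,
where the formula follows from the independence of the counts in disjoint sets. Almost surely all
pairs of points are in general position (`ae_pairwise_inGeneralPosition`), and then the discretized
counts are eventually equal to the true one, so that both sides converge by domination. This also
yields the measurability of the counts. The areas are computed in
`volume_forwardTriangle_union_backwardTriangle`, the integrals in `lintegral_quadrant_exp_neg` and
the lemmas after it, and `chosenCount_eq`, `mutualCount_eq` and `degreeSum_add_sum_eq` express the
counts of the graph by numbers of pairs with void triangles.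
-/

open Filter Topology

/-! ### Counts of a unit Poisson process -/

lemma lintegral_poissonMeasure (r : ℝ≥0) (f : ℕ → ℝ≥0∞) :
    ∫⁻ n, f n ∂(poissonMeasure r) =
      ∑' n : ℕ, ENNReal.ofReal (Real.exp (-r) * r ^ n / n.factorial) * f n := by
  rw [poissonMeasure, lintegral_sum_measure]
  simp

lemma lintegral_natCast_poissonMeasure (r : ℝ≥0) :
    ∫⁻ n, (n : ℝ≥0∞) ∂(poissonMeasure r) = r := by
  rw [lintegral_poissonMeasure, tsum_eq_zero_add' ENNReal.summable]
  have h : ∀ n : ℕ, ENNReal.ofReal (Real.exp (-r) * r ^ (n + 1) / (n + 1).factorial) *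
      ((n + 1 : ℕ) : ℝ≥0∞) = r * poissonMeasure r {n} := by
    intro n
    rw [poissonMeasure_singleton, ← ENNReal.ofReal_natCast, ← ENNReal.ofReal_mul (by positivity),
      ← ENNReal.ofReal_coe_nnreal, ← ENNReal.ofReal_mul (by positivity)]
    congr 1
    rw [Nat.factorial_succ]
    push_cast
    field_simp
    ring
  simp only [h, CharP.cast_eq_zero, mul_zero, zero_add]
  rw [ENNReal.tsum_mul_left]
  have : ∑' n : ℕ, poissonMeasure r {n} = 1 := by
    simpa using Measure.tsum_indicator_apply_singleton (poissonMeasure r) Set.univ .univ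
  rw [this, mul_one]

lemma lintegral_natCast_sq_poissonMeasure_lt_top (r : ℝ≥0) :
    ∫⁻ n, (n : ℝ≥0∞) ^ 2 ∂(poissonMeasure r) < ∞ := by
  rw [lintegral_poissonMeasure]
  have hsum : Summable fun n : ℕ => Real.exp (-r) * ((4 * r) ^ n / n.factorial) :=
    (Real.summable_pow_div_factorial _).mul_left _
  -- `n ^ 2 ≤ 4 ^ n` turns the series into an exponential series
  refine lt_of_le_of_lt (ENNReal.tsum_le_tsum fun n => ?_) (hsum.tsum_ofReal_lt_top)
  rw [← ENNReal.ofReal_natCast, ← ENNReal.ofReal_pow (by positivity),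
    ← ENNReal.ofReal_mul (by positivity)]
  apply ENNReal.ofReal_le_ofReal
  have h1 : (n : ℝ) ^ 2 ≤ 4 ^ n := by
    have : (n : ℝ) ≤ 2 ^ n := by exact_mod_cast Nat.lt_two_pow_self.le
    calc (n : ℝ) ^ 2 ≤ (2 ^ n) ^ 2 := by gcongr
      _ = 4 ^ n := by rw [← pow_mul, mul_comm, pow_mul]; norm_num
  rw [mul_pow, mul_div_assoc, mul_assoc]
  gcongr
  rw [div_mul_eq_mul_div, mul_comm]
  gcongr

section Counts

variable {Ω : Type*} [MeasurableSpace Ω] {P : Measure Ω} {Φ : Ω → Set ℂ}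

namespace IsUnitPoissonProcess

lemma measurable_toENNReal_encard (hΦ : IsUnitPoissonProcess P Φ) {A : Set ℂ}
    (hA : MeasurableSet A) : Measurable fun ω => ((Φ ω ∩ A).encard : ℝ≥0∞) :=
  (Measurable.of_discrete (f := fun n : ℕ∞ => (n : ℝ≥0∞))).comp (hΦ.measurable_count A hA)

lemma measure_encard_eq_zero (hΦ : IsUnitPoissonProcess P Φ) {A : Set ℂ} (hA : MeasurableSet A)
    (hA' : volume A ≠ ∞) :
    P {ω | (Φ ω ∩ A).encard = 0} = ENNReal.ofReal (Real.exp (-(volume A).toReal)) := by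
  have := hΦ.poisson_count A hA hA' 0
  rw [poissonMeasure_singleton] at this
  simpa [ENNReal.coe_toNNReal_eq_toReal] using this

variable [IsProbabilityMeasure P]

/-- The law of a count, as a measure on `ℕ∞`. Only the masses of the finite values are given, but
these add up to `1`. -/
lemma map_encard (hΦ : IsUnitPoissonProcess P Φ) {A : Set ℂ} (hA : MeasurableSet A)
    (hA' : volume A ≠ ∞) :
    P.map (fun ω => (Φ ω ∩ A).encard) =
      (poissonMeasure (volume A).toNNReal).map (Nat.cast : ℕ → ℕ∞) := by
  have hm := hΦ.measurable_count A hA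
  have : IsProbabilityMeasure (P.map (fun ω => (Φ ω ∩ A).encard)) :=
    Measure.isProbabilityMeasure_map hm.aemeasurable
  symm
  apply Measure.eq_of_le_of_isProbabilityMeasure
  rw [Measure.le_iff]
  intro s hs
  rw [← Measure.tsum_indicator_apply_singleton _ s hs,
    ← Measure.tsum_indicator_apply_singleton _ s hs]
  refine ENNReal.tsum_le_tsum fun x => Set.indicator_le_indicator ?_
  rw [Measure.map_apply .of_discrete (measurableSet_singleton _),
    Measure.map_apply hm (measurableSet_singleton _)]
  induction x using ENat.recTopCoe with
  | top =>
    have : (Nat.cast ⁻¹' {(⊤ : ℕ∞)} : Set ℕ) = ∅ := by ext; simp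
    simp [this]
  | coe n =>
    have : (Nat.cast ⁻¹' {(n : ℕ∞)} : Set ℕ) = {n} := by ext; simp
    rw [this, ← hΦ.poisson_count A hA hA' n]
    rfl

lemma lintegral_comp_encard (hΦ : IsUnitPoissonProcess P Φ) {A : Set ℂ} (hA : MeasurableSet A)
    (hA' : volume A ≠ ∞) (f : ℕ∞ → ℝ≥0∞) :
    ∫⁻ ω, f (Φ ω ∩ A).encard ∂P = ∫⁻ n, f n ∂(poissonMeasure (volume A).toNNReal) := by
  rw [← lintegral_map (f := f) .of_discrete (hΦ.measurable_count A hA), hΦ.map_encard hA hA',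
    lintegral_map .of_discrete .of_discrete]

lemma lintegral_encard (hΦ : IsUnitPoissonProcess P Φ) {A : Set ℂ} (hA : MeasurableSet A)
    (hA' : volume A ≠ ∞) : ∫⁻ ω, ((Φ ω ∩ A).encard : ℝ≥0∞) ∂P = volume A := by
  rw [hΦ.lintegral_comp_encard hA hA' (fun n => (n : ℝ≥0∞))]
  simp only [ENat.toENNReal_coe]
  rw [lintegral_natCast_poissonMeasure, ENNReal.coe_toNNReal hA']

lemma lintegral_encard_sq_lt_top (hΦ : IsUnitPoissonProcess P Φ) {A : Set ℂ}
    (hA : MeasurableSet A) (hA' : volume A ≠ ∞) :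
    ∫⁻ ω, ((Φ ω ∩ A).encard : ℝ≥0∞) ^ 2 ∂P < ∞ := by
  rw [hΦ.lintegral_comp_encard hA hA' (fun n => (n : ℝ≥0∞) ^ 2)]
  exact lintegral_natCast_sq_poissonMeasure_lt_top _

lemma measure_two_le_encard_le (hΦ : IsUnitPoissonProcess P Φ) {A : Set ℂ}
    (hA : MeasurableSet A) (hA' : volume A ≠ ∞) :
    P {ω | 2 ≤ (Φ ω ∩ A).encard} ≤ volume A ^ 2 := by
  have hm := hΦ.measurable_count A hA
  have hset : {ω | 2 ≤ (Φ ω ∩ A).encard}ᶜ =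
      {ω | (Φ ω ∩ A).encard = (0 : ℕ)} ∪ {ω | (Φ ω ∩ A).encard = (1 : ℕ)} := by
    ext ω
    simp only [Set.mem_compl_iff, Set.mem_ofPred_eq, not_le, Set.mem_union]
    generalize (Φ ω ∩ A).encard = n
    induction n using ENat.recTopCoe with
    | top => simp
    | coe n => norm_cast; omega
  have hM : MeasurableSet {ω | 2 ≤ (Φ ω ∩ A).encard} :=
    hm (MeasurableSet.of_discrete (s := Set.Ici 2))
  have hc := prob_compl_eq_one_sub (μ := P) hM.compl
  rw [compl_compl] at hc
  have hM1 : MeasurableSet {ω | (Φ ω ∩ A).encard = (1 : ℕ)} :=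
    hm (MeasurableSet.of_discrete (s := {((1 : ℕ) : ℕ∞)}))
  have hdisj : Disjoint {ω | (Φ ω ∩ A).encard = (0 : ℕ)} {ω | (Φ ω ∩ A).encard = (1 : ℕ)} := by
    rw [Set.disjoint_left]
    intro ω h0 h1
    simp only [Set.mem_ofPred_eq] at h0 h1
    rw [h0] at h1
    norm_num at h1
  rw [hc, hset, measure_union hdisj hM1,
    hΦ.poisson_count A hA hA', hΦ.poisson_count A hA hA', poissonMeasure_singleton,
    poissonMeasure_singleton, ← ENNReal.ofReal_add (by positivity) (by positivity),
    ← ENNReal.ofReal_one, ← ENNReal.ofReal_sub _ (by positivity)]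
  conv_rhs => rw [← ENNReal.coe_toNNReal hA', ← ENNReal.ofReal_coe_nnreal,
    ← ENNReal.ofReal_pow (by positivity)]
  apply ENNReal.ofReal_le_ofReal
  set r : ℝ := ((volume A).toNNReal : ℝ)
  have hr : 0 ≤ r := NNReal.coe_nonneg _
  have := Real.add_one_le_exp (-r)
  simp only [pow_zero, mul_one, Nat.factorial_zero, Nat.cast_one, div_one, pow_one,
    Nat.factorial_one]
  nlinarith

/-- The expectation of the product of two counts over the event that a third set is void, for
pairwise disjoint sets. -/
lemma lintegral_encard_mul_encard_mul_void (hΦ : IsUnitPoissonProcess P Φ) {A B V : Set ℂ}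
    (hA : MeasurableSet A) (hB : MeasurableSet B) (hV : MeasurableSet V) (hA' : volume A ≠ ∞)
    (hB' : volume B ≠ ∞) (hV' : volume V ≠ ∞) (hAB : Disjoint A B) (hAV : Disjoint A V)
    (hBV : Disjoint B V) :
    ∫⁻ ω, ((Φ ω ∩ A).encard : ℝ≥0∞) * (Φ ω ∩ B).encard *
        (Set.indicator {0} 1 (Φ ω ∩ V).encard : ℝ≥0∞) ∂P =
      volume A * volume B * ENNReal.ofReal (Real.exp (-(volume V).toReal)) := by
  have hind := hΦ.indep_count 3 ![A, B, V]
    (by intro j; fin_cases j <;> simpa) (by intro j; fin_cases j <;> simpa)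
    (by
      intro j l hjl
      fin_cases j <;> fin_cases l <;> simp_all [disjoint_comm])
  have hind' := hind.comp
    (![fun n => (n : ℝ≥0∞), fun n => (n : ℝ≥0∞), Set.indicator {0} 1] :
      Fin 3 → ℕ∞ → ℝ≥0∞) (fun _ => .of_discrete)
  have hmeas : ∀ j : Fin 3, Measurable fun ω => (Φ ω ∩ (![A, B, V] : Fin 3 → Set ℂ) j).encard := by
    intro j
    apply hΦ.measurable_count
    fin_cases j <;> simpa
  have h := lintegral_prod_eq_prod_lintegral_of_indepFun Finset.univ _ hind'
    (fun j => Measurable.of_discrete.comp (hmeas j))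
  simp only [Fin.prod_univ_three, Function.comp_apply, Matrix.cons_val_zero, Matrix.cons_val_one,
    Matrix.cons_val_two] at h
  refine h.trans ?_
  rw [ hΦ.lintegral_encard hA hA', hΦ.lintegral_encard hB hB']
  congr 1
  rw [← hΦ.measure_encard_eq_zero hV hV']
  have : (fun ω => (Set.indicator {0} 1 (Φ ω ∩ V).encard : ℝ≥0∞)) =
      Set.indicator {ω | (Φ ω ∩ V).encard = 0} 1 := by
    ext ω
    simp [Set.indicator_apply]
  change ∫⁻ ω, (fun ω => (Set.indicator {0} 1 (Φ ω ∩ V).encard : ℝ≥0∞)) ω ∂P = _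
  rw [this, lintegral_indicator_one]
  exact hΦ.measurable_count V hV (measurableSet_singleton _)

end IsUnitPoissonProcess

end Counts

/-! ### Sums over pairs of cells -/

section Cells

variable {α β : Type*} [MeasurableSpace α]

/-- The sum over the pairs of cells of a simple function `s`, of a weight that depends only on the
cells, is a double integral. -/
lemma sum_sum_measure_preimage_eq_lintegral (s : SimpleFunc α β) (μ ν : Measure α)
    (h : β → β → ℝ≥0∞) :
    ∑ p ∈ s.range, ∑ q ∈ s.range, h p q * (μ (s ⁻¹' {p}) * ν (s ⁻¹' {q})) =
      ∫⁻ u, ∫⁻ w, h (s u) (s w) ∂ν ∂μ := by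
  have key : ∀ (κ : Measure α) (f : β → ℝ≥0∞),
      ∫⁻ w, f (s w) ∂κ = ∑ q ∈ s.range, f q * κ (s ⁻¹' {q}) := by
    intro κ f
    rw [← SimpleFunc.map_lintegral, ← SimpleFunc.lintegral_eq_lintegral]
    rfl
  rw [key μ fun p => ∫⁻ w, h p (s w) ∂ν]
  refine Finset.sum_congr rfl fun p _ => ?_
  rw [key ν, Finset.sum_mul]
  exact Finset.sum_congr rfl fun q _ => by ring

/-- Dominated convergence for double integrals of functions that depend only on the cells. -/
lemma tendsto_lintegral_lintegral_simpleFunc {s : ℕ → SimpleFunc α β} {μ ν : Measure α}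
    [IsFiniteMeasure μ] [IsFiniteMeasure ν] {h : ℕ → β → β → ℝ≥0∞} {g : α → α → ℝ≥0∞}
    (h_le : ∀ n p q, h n p q ≤ 1)
    (h_lim : ∀ᵐ u ∂μ, ∀ᵐ w ∂ν, Tendsto (fun n => h n (s n u) (s n w)) atTop (𝓝 (g u w))) :
    Tendsto (fun n => ∫⁻ u, ∫⁻ w, h n (s n u) (s n w) ∂ν ∂μ) atTop
      (𝓝 (∫⁻ u, ∫⁻ w, g u w ∂ν ∂μ)) := by
  refine tendsto_lintegral_of_dominated_convergence (fun _ => ν Set.univ) (fun n => ?_)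
    (fun n => .of_forall fun u => ?_) ?_ ?_
  · exact ((s n).map fun p => ∫⁻ w, h n p (s n w) ∂ν).measurable
  · calc ∫⁻ w, h n (s n u) (s n w) ∂ν ≤ ∫⁻ w, 1 ∂ν := lintegral_mono fun w => h_le _ _ _
      _ = ν Set.univ := lintegral_one
  · simpa using ENNReal.mul_ne_top (measure_ne_top _ _) (measure_ne_top _ _)
  · filter_upwards [h_lim] with u hu
    refine tendsto_lintegral_of_dominated_convergence (fun _ => 1) (fun n => ?_)
      (fun n => .of_forall fun w => h_le _ _ _) ?_ hu
    · exact ((s n).map fun q => h n (s n u) q).measurable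
    · simp

lemma eventually_ne_of_tendsto {X Y : Type*} [TopologicalSpace Y] [T2Space Y] {s : ℕ → X → Y}
    {f : X → Y} (hs : ∀ x, Tendsto (fun n => s n x) atTop (𝓝 (f x))) {x y : X} (hxy : f x ≠ f y) :
    ∀ᶠ n in atTop, s n x ≠ s n y := by
  obtain ⟨U, V, hU, hV, hxU, hyV, hUV⟩ := t2_separation hxy
  filter_upwards [(hs x).eventually_mem (hU.mem_nhds hxU),
    (hs y).eventually_mem (hV.mem_nhds hyV)] with n h1 h2 h
  exact Set.disjoint_left.1 hUV h1 (h ▸ h2)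

lemma count_restrict_apply [MeasurableSingletonClass α] {S : Set α} (hS : S.Finite) {t : Set α}
    (ht : MeasurableSet t) : (Measure.count.restrict S) t = ((t ∩ S).encard : ℝ≥0∞) := by
  rw [Measure.restrict_apply ht, Measure.count_apply (ht.inter hS.measurableSet)]

lemma isFiniteMeasure_count_restrict [MeasurableSingletonClass α] {S : Set α} (hS : S.Finite) :
    IsFiniteMeasure ((Measure.count : Measure α).restrict S) :=
  ⟨by simpa using Measure.count_apply_lt_top.2 hS⟩

end Cells

/-! ### General position -/

lemma ae_map_sub_ne_zero {l : ℂ →L[ℝ] ℝ} (hl : l ≠ 0) (x : ℂ) : ∀ᵐ y, l (x - y) ≠ 0 := by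
  have h0 : volume {z : ℂ | l z = 0} = 0 := by
    refine Measure.addHaar_submodule volume (LinearMap.ker (l : ℂ →ₗ[ℝ] ℝ)) fun h => hl ?_
    ext z
    have : z ∈ LinearMap.ker (l : ℂ →ₗ[ℝ] ℝ) := h ▸ Submodule.mem_top
    simpa using this
  have h1 : volume ((fun y => x - y) ⁻¹' {z : ℂ | l z = 0}) = 0 := by
    rw [(Measure.measurePreserving_sub_left volume x).measure_preimage
      (measurableSet_eq_fun l.continuous.measurable measurable_const).nullMeasurableSet, h0]
  rw [ae_iff]
  simpa using h1

section PoissonCounts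

variable {Ω : Type*} [MeasurableSpace Ω] {P : Measure Ω} [IsProbabilityMeasure P]
  {Φ : Ω → Set ℂ}

/-- Almost surely no two points of the process lie on a common line `l = const`: in a bounded
window cut into thin strips, the probability that some strip holds two points is at most the sum of
the squared areas of the strips. -/
lemma IsUnitPoissonProcess.ae_pairwise_map_sub_ne_zero (hΦ : IsUnitPoissonProcess P Φ)
    {l : ℂ →L[ℝ] ℝ} (hl : l ≠ 0) : ∀ᵐ ω ∂P, (Φ ω).Pairwise fun x y => l (x - y) ≠ 0 := by
  suffices h : ∀ r : ℕ, ∀ᵐ ω ∂P,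
      (Φ ω ∩ Metric.ball 0 (r : ℝ)).Pairwise fun x y => l (x - y) ≠ 0 by
    filter_upwards [ae_all_iff.2 h] with ω hω x hx y hy hxy
    obtain ⟨r, hr⟩ := exists_nat_gt (max ‖x‖ ‖y‖)
    exact hω r ⟨hx, by simpa using (le_max_left _ _).trans_lt hr⟩
      ⟨hy, by simpa using (le_max_right _ _).trans_lt hr⟩ hxy
  intro r
  set W : Set ℂ := Metric.ball 0 (r : ℝ)
  have hW : MeasurableSet W := measurableSet_ball
  have hWfin : volume W ≠ ∞ := measure_ball_lt_top.ne
  have : IsFiniteMeasure (volume.restrict W) := ⟨by simpa using hWfin.lt_top⟩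
  set s : ℕ → SimpleFunc ℂ ℝ :=
    fun n => (stronglyMeasurable_id.approx n : SimpleFunc ℝ ℝ).comp l l.continuous.measurable
  have hs : ∀ z, Tendsto (fun n => s n z) atTop (𝓝 (l z)) :=
    fun z => (stronglyMeasurable_id (α := ℝ)).tendsto_approx (l z)
  have hstrip : ∀ n p, MeasurableSet (s n ⁻¹' {p} ∩ W) :=
    fun n p => ((s n).measurableSet_preimage _).inter hW
  have hstrip' : ∀ n p, volume (s n ⁻¹' {p} ∩ W) ≠ ∞ :=
    fun n p => measure_ne_top_of_subset Set.inter_subset_right hWfin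
  -- the double integral is the sum of the squared areas of the strips
  have hle : ∀ n, P {ω | ¬ (Φ ω ∩ W).Pairwise fun x y => l (x - y) ≠ 0} ≤
      ∫⁻ u in W, ∫⁻ w in W, (fun p q => if p = q then 1 else 0) (s n u) (s n w) := by
    intro n
    calc P {ω | ¬ (Φ ω ∩ W).Pairwise fun x y => l (x - y) ≠ 0}
        ≤ P (⋃ p ∈ (s n).range, {ω | 2 ≤ (Φ ω ∩ (s n ⁻¹' {p} ∩ W)).encard}) := by
          apply measure_mono
          intro ω hω
          simp only [Set.mem_ofPred_eq, Set.Pairwise, not_forall, not_not] at hω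
          obtain ⟨x, hx, y, hy, hxy, hl0⟩ := hω
          have hlxy : l x = l y := by rwa [map_sub, sub_eq_zero] at hl0
          refine Set.mem_biUnion (x := s n x) (SimpleFunc.mem_range_self _ _) ?_
          rw [Set.mem_ofPred_eq, ← Set.encard_pair hxy]
          apply Set.encard_le_encard
          rintro z (rfl | rfl)
          · exact ⟨hx.1, rfl, hx.2⟩
          · refine ⟨hy.1, ?_, hy.2⟩
            simp [s, hlxy]
      _ ≤ ∑ p ∈ (s n).range, P {ω | 2 ≤ (Φ ω ∩ (s n ⁻¹' {p} ∩ W)).encard} :=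
          measure_biUnion_finset_le _ _
      _ ≤ ∑ p ∈ (s n).range, volume (s n ⁻¹' {p} ∩ W) ^ 2 :=
          Finset.sum_le_sum fun p _ => hΦ.measure_two_le_encard_le (hstrip n p) (hstrip' n p)
      _ = _ := by
          refine Eq.trans ?_ (sum_sum_measure_preimage_eq_lintegral (s n) (volume.restrict W)
            (volume.restrict W) fun p q => if p = q then 1 else 0)
          refine Finset.sum_congr rfl fun p hp => ?_
          simp [Measure.restrict_apply ((s n).measurableSet_preimage _), sq,
            (SimpleFunc.mem_range.1 hp)]
  have hlim := tendsto_lintegral_lintegral_simpleFunc (s := s) (μ := volume.restrict W)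
    (ν := volume.restrict W) (h := fun _ p q => if p = q then 1 else 0) (g := fun _ _ => 0)
    (fun n p q => by split_ifs <;> simp) (.of_forall fun u => ae_restrict_of_ae <| by
      filter_upwards [ae_map_sub_ne_zero hl u] with w hw
      refine tendsto_const_nhds.congr' ?_
      have hne : l u ≠ l w := by rwa [map_sub, sub_ne_zero] at hw
      filter_upwards [eventually_ne_of_tendsto hs hne] with n hn
      simp [hn])
  rw [ae_iff]
  refine le_antisymm ?_ zero_le
  simpa using ge_of_tendsto' hlim hle

end PoissonCounts

/-! ### Sectors and void regions -/

/-- The half-open convex cone with apex `0` that corresponds, in the linear coordinates `φ`, to the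
first quadrant: positive first and nonnegative second coordinate. -/
def sector (φ : ℂ ≃L[ℝ] ℝ × ℝ) : Set ℂ := {z | 0 < (φ z).1 ∧ 0 ≤ (φ z).2}

/-- The sum of the two coordinates, a linear form that is positive on `sector φ`. -/
noncomputable def level (φ : ℂ ≃L[ℝ] ℝ × ℝ) : ℂ →L[ℝ] ℝ :=
  (ContinuousLinearMap.fst ℝ ℝ ℝ + ContinuousLinearMap.snd ℝ ℝ ℝ) ∘L (φ : ℂ →L[ℝ] ℝ × ℝ)

lemma level_apply (φ : ℂ ≃L[ℝ] ℝ × ℝ) (z : ℂ) : level φ z = (φ z).1 + (φ z).2 := rfl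

/-- Two points are in general position if they lie on no common line parallel to a side of
`sector φ` or to the level lines. -/
def InGeneralPosition (φ : ℂ ≃L[ℝ] ℝ × ℝ) (x y : ℂ) : Prop :=
  (φ (x - y)).1 ≠ 0 ∧ (φ (x - y)).2 ≠ 0 ∧ level φ (x - y) ≠ 0

lemma InGeneralPosition.ne {φ : ℂ ≃L[ℝ] ℝ × ℝ} {x y : ℂ} (h : InGeneralPosition φ x y) :
    x ≠ y := by
  rintro rfl
  simpa using h.1

lemma measurableSet_sector (φ : ℂ ≃L[ℝ] ℝ × ℝ) : MeasurableSet (sector φ) := by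
  have h := φ.continuous.measurable
  exact (measurableSet_lt measurable_const h.fst).inter (measurableSet_le measurable_const h.snd)

lemma zero_notMem_sector (φ : ℂ ≃L[ℝ] ℝ × ℝ) : (0 : ℂ) ∉ sector φ := by
  simp [sector]

lemma fst_comp_ne_zero (φ : ℂ ≃L[ℝ] ℝ × ℝ) :
    ContinuousLinearMap.fst ℝ ℝ ℝ ∘L (φ : ℂ →L[ℝ] ℝ × ℝ) ≠ 0 := fun h => by
  simpa using DFunLike.congr_fun h (φ.symm (1, 0))

lemma snd_comp_ne_zero (φ : ℂ ≃L[ℝ] ℝ × ℝ) :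
    ContinuousLinearMap.snd ℝ ℝ ℝ ∘L (φ : ℂ →L[ℝ] ℝ × ℝ) ≠ 0 := fun h => by
  simpa using DFunLike.congr_fun h (φ.symm (0, 1))

lemma level_ne_zero (φ : ℂ ≃L[ℝ] ℝ × ℝ) : level φ ≠ 0 := fun h => by
  simpa [level_apply] using DFunLike.congr_fun h (φ.symm (1, 0))

lemma ae_inGeneralPosition (φ : ℂ ≃L[ℝ] ℝ × ℝ) (x : ℂ) : ∀ᵐ y, InGeneralPosition φ x y := by
  filter_upwards [ae_map_sub_ne_zero (fst_comp_ne_zero φ) x,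
    ae_map_sub_ne_zero (snd_comp_ne_zero φ) x, ae_map_sub_ne_zero (level_ne_zero φ) x]
    with y h1 h2 h3 using ⟨h1, h2, h3⟩

lemma InGeneralPosition.symm {φ : ℂ ≃L[ℝ] ℝ × ℝ} {x y : ℂ} (h : InGeneralPosition φ x y) :
    InGeneralPosition φ y x := by
  rw [InGeneralPosition, ← neg_sub x y]
  simpa only [InGeneralPosition, map_neg, Prod.fst_neg, Prod.snd_neg, neg_ne_zero] using h

lemma IsUnitPoissonProcess.ae_pairwise_inGeneralPosition {Ω : Type*} [MeasurableSpace Ω]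
    {P : Measure Ω} [IsProbabilityMeasure P] {Φ : Ω → Set ℂ} (hΦ : IsUnitPoissonProcess P Φ)
    (φ : ℂ ≃L[ℝ] ℝ × ℝ) : ∀ᵐ ω ∂P, (Φ ω).Pairwise (InGeneralPosition φ) := by
  filter_upwards [hΦ.ae_pairwise_map_sub_ne_zero (fst_comp_ne_zero φ),
    hΦ.ae_pairwise_map_sub_ne_zero (snd_comp_ne_zero φ),
    hΦ.ae_pairwise_map_sub_ne_zero (level_ne_zero φ)] with ω h1 h2 h3
  exact fun x hx y hy hxy => ⟨h1 hx hy hxy, h2 hx hy hxy, h3 hx hy hxy⟩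

/-- Strict inequalities are stable under small perturbations. -/
lemma eventually_lt_iff {X : Type*} [TopologicalSpace X] {f g : X → ℝ} {x : X}
    (hf : ContinuousAt f x) (hg : ContinuousAt g x) (hne : f x ≠ g x) :
    ∀ᶠ y in 𝓝 x, (f y < g y ↔ f x < g x) := by
  rcases hne.lt_or_gt with h | h
  · filter_upwards [hf.eventually_lt hg h] with y hy using ⟨fun _ => h, fun _ => hy⟩
  · filter_upwards [hg.eventually_lt hf h] with y hy using
      ⟨fun h' => absurd h' hy.not_gt, fun h' => absurd h' h.not_gt⟩

lemma eventually_le_iff {X : Type*} [TopologicalSpace X] {f g : X → ℝ} {x : X}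
    (hf : ContinuousAt f x) (hg : ContinuousAt g x) (hne : f x ≠ g x) :
    ∀ᶠ y in 𝓝 x, (f y ≤ g y ↔ f x ≤ g x) := by
  filter_upwards [eventually_lt_iff hg hf hne.symm] with y hy
  rw [← not_lt, hy, not_lt]

lemma eventually_mem_sector_iff {X : Type*} [TopologicalSpace X] (φ : ℂ ≃L[ℝ] ℝ × ℝ) {f : X → ℂ}
    {x : X} (hf : ContinuousAt f x) (h1 : (φ (f x)).1 ≠ 0) (h2 : (φ (f x)).2 ≠ 0) :
    ∀ᶠ y in 𝓝 x, (f y ∈ sector φ ↔ f x ∈ sector φ) := by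
  have hc : ContinuousAt (fun y => φ (f y)) x := φ.continuous.continuousAt.comp hf
  filter_upwards [eventually_lt_iff continuousAt_const hc.fst h1.symm,
    eventually_le_iff continuousAt_const hc.snd h2.symm] with y hy1 hy2
  exact and_congr hy1 hy2

/-- Regions `R u w`, attached to the pairs of points, which vary stably: whether a point lies in
`R u w` does not change under small perturbations of `u` and `w`, if the three points are in
general position. -/
structure IsStableRegion (φ : ℂ ≃L[ℝ] ℝ × ℝ) (R : ℂ → ℂ → Set ℂ) : Prop where
  measurableSet : ∀ u w, MeasurableSet (R u w)
  left_notMem : ∀ u w, u ∉ R u w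
  right_notMem : ∀ u w, w ∉ R u w
  exists_bounded : ∀ u w, ∃ r : ℝ, ∀ᶠ q : ℂ × ℂ in 𝓝 (u, w), R q.1 q.2 ⊆ Metric.closedBall 0 r
  eventually_mem_iff : ∀ u w v, InGeneralPosition φ u w → InGeneralPosition φ v u →
    InGeneralPosition φ v w → ∀ᶠ q : ℂ × ℂ in 𝓝 (u, w), (v ∈ R q.1 q.2 ↔ v ∈ R u w)

lemma IsStableRegion.union {φ : ℂ ≃L[ℝ] ℝ × ℝ} {R R' : ℂ → ℂ → Set ℂ} (h : IsStableRegion φ R)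
    (h' : IsStableRegion φ R') : IsStableRegion φ fun u w => R u w ∪ R' u w where
  measurableSet u w := (h.measurableSet u w).union (h'.measurableSet u w)
  left_notMem u w := by simp [h.left_notMem, h'.left_notMem]
  right_notMem u w := by simp [h.right_notMem, h'.right_notMem]
  exists_bounded u w := by
    obtain ⟨r, hr⟩ := h.exists_bounded u w
    obtain ⟨r', hr'⟩ := h'.exists_bounded u w
    refine ⟨max r r', ?_⟩
    filter_upwards [hr, hr'] with q hq hq'
    exact Set.union_subset (hq.trans (Metric.closedBall_subset_closedBall (le_max_left _ _)))
      (hq'.trans (Metric.closedBall_subset_closedBall (le_max_right _ _)))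
  eventually_mem_iff u w v h1 h2 h3 := by
    filter_upwards [h.eventually_mem_iff u w v h1 h2 h3, h'.eventually_mem_iff u w v h1 h2 h3]
      with q hq hq'
    exact or_congr hq hq'

lemma IsStableRegion.volume_ne_top {φ : ℂ ≃L[ℝ] ℝ × ℝ} {R : ℂ → ℂ → Set ℂ}
    (h : IsStableRegion φ R) (u w : ℂ) : volume (R u w) ≠ ∞ := by
  obtain ⟨r, hr⟩ := h.exists_bounded u w
  exact measure_ne_top_of_subset hr.self_of_nhds measure_closedBall_lt_top.ne

/-- The half-open triangle of the points of the sector with apex `u` that lie strictly below the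
level of `w`. -/
def forwardTriangle (φ : ℂ ≃L[ℝ] ℝ × ℝ) (u w : ℂ) : Set ℂ :=
  {v | v - u ∈ sector φ ∧ level φ (v - u) < level φ (w - u)}

/-- The half-open triangle of the points of the opposite sector with apex `w` that lie strictly
above the level of `u`. -/
def backwardTriangle (φ : ℂ ≃L[ℝ] ℝ × ℝ) (u w : ℂ) : Set ℂ :=
  {v | w - v ∈ sector φ ∧ level φ (w - v) < level φ (w - u)}

lemma norm_le_of_mem_sector (φ : ℂ ≃L[ℝ] ℝ × ℝ) {z : ℂ} (hz : z ∈ sector φ) :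
    ‖z‖ ≤ ‖(φ.symm : ℝ × ℝ →L[ℝ] ℂ)‖ * level φ z := by
  calc ‖z‖ = ‖(φ.symm : ℝ × ℝ →L[ℝ] ℂ) (φ z)‖ := by simp
    _ ≤ ‖(φ.symm : ℝ × ℝ →L[ℝ] ℂ)‖ * ‖φ z‖ := ContinuousLinearMap.le_opNorm _ _
    _ ≤ _ := by
      gcongr
      obtain ⟨h1, h2⟩ := hz
      rw [Prod.norm_def, level_apply, Real.norm_of_nonneg h1.le, Real.norm_of_nonneg h2]
      exact max_le (by linarith) (by linarith)

/-- A bound on the size of both triangles, locally uniform in `u` and `w`. -/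
lemma eventually_norm_add_level_le (φ : ℂ ≃L[ℝ] ℝ × ℝ) (u w : ℂ) : ∃ r : ℝ,
    ∀ᶠ q : ℂ × ℂ in 𝓝 (u, w),
      ‖q.1‖ + ‖q.2‖ + ‖(φ.symm : ℝ × ℝ →L[ℝ] ℂ)‖ * level φ (q.2 - q.1) ≤ r := by
  have hc : Continuous fun q : ℂ × ℂ =>
      ‖q.1‖ + ‖q.2‖ + ‖(φ.symm : ℝ × ℝ →L[ℝ] ℂ)‖ * level φ (q.2 - q.1) := by fun_prop
  refine ⟨_, (hc.continuousAt.eventually_lt continuousAt_const (lt_add_one _)).mono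
    fun q hq => hq.le⟩

lemma isStableRegion_forwardTriangle (φ : ℂ ≃L[ℝ] ℝ × ℝ) :
    IsStableRegion φ (forwardTriangle φ) where
  measurableSet u w := by
    refine MeasurableSet.inter ((measurable_id.sub_const u) (measurableSet_sector φ)) ?_
    exact measurableSet_lt (by fun_prop : Measurable fun v => level φ (v - u)) measurable_const
  left_notMem u w h := zero_notMem_sector φ (by simpa using h.1)
  right_notMem u w h := lt_irrefl _ h.2
  exists_bounded u w := by
    obtain ⟨r, hr⟩ := eventually_norm_add_level_le φ u w
    refine ⟨r, hr.mono fun q hq v hv => ?_⟩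
    rw [mem_closedBall_zero_iff]
    have h1 := norm_le_of_mem_sector φ hv.1
    have h2 : ‖(φ.symm : ℝ × ℝ →L[ℝ] ℂ)‖ * level φ (v - q.1) ≤
        ‖(φ.symm : ℝ × ℝ →L[ℝ] ℂ)‖ * level φ (q.2 - q.1) := by gcongr; exact hv.2.le
    have h3 : ‖v‖ ≤ ‖v - q.1‖ + ‖q.1‖ := by simpa using norm_add_le (v - q.1) q.1
    linarith [norm_nonneg q.2]
  eventually_mem_iff u w v _ hu hw := by
    have e1 := eventually_mem_sector_iff φ (f := fun q : ℂ × ℂ => v - q.1) (x := (u, w))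
      (by fun_prop) hu.1 hu.2.1
    have e2 := eventually_lt_iff (f := fun q : ℂ × ℂ => level φ (v - q.1))
      (g := fun q : ℂ × ℂ => level φ (q.2 - q.1)) (x := (u, w)) (by fun_prop) (by fun_prop)
      (by
        have := hw.2.2
        rw [map_sub, sub_ne_zero] at this
        simpa using this)
    filter_upwards [e1, e2] with q h1 h2 using and_congr h1 h2

lemma isStableRegion_backwardTriangle (φ : ℂ ≃L[ℝ] ℝ × ℝ) :
    IsStableRegion φ (backwardTriangle φ) where
  measurableSet u w := by
    refine MeasurableSet.inter ((measurable_id.const_sub w) (measurableSet_sector φ)) ?_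
    exact measurableSet_lt (by fun_prop : Measurable fun v => level φ (w - v)) measurable_const
  left_notMem u w h := lt_irrefl _ h.2
  right_notMem u w h := zero_notMem_sector φ (by simpa using h.1)
  exists_bounded u w := by
    obtain ⟨r, hr⟩ := eventually_norm_add_level_le φ u w
    refine ⟨r, hr.mono fun q hq v hv => ?_⟩
    rw [mem_closedBall_zero_iff]
    have h1 := norm_le_of_mem_sector φ hv.1
    have h2 : ‖(φ.symm : ℝ × ℝ →L[ℝ] ℂ)‖ * level φ (q.2 - v) ≤
        ‖(φ.symm : ℝ × ℝ →L[ℝ] ℂ)‖ * level φ (q.2 - q.1) := by gcongr; exact hv.2.le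
    have h3 : ‖v‖ ≤ ‖q.2‖ + ‖q.2 - v‖ := by simpa using norm_sub_le q.2 (q.2 - v)
    linarith [norm_nonneg q.1]
  eventually_mem_iff u w v _ hu hw := by
    have e1 := eventually_mem_sector_iff φ (f := fun q : ℂ × ℂ => q.2 - v) (x := (u, w))
      (by fun_prop) hw.symm.1 hw.symm.2.1
    have e2 := eventually_lt_iff (f := fun q : ℂ × ℂ => level φ (q.2 - v))
      (g := fun q : ℂ × ℂ => level φ (q.2 - q.1)) (x := (u, w)) (by fun_prop) (by fun_prop)
      (by
        have := hu.2.2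
        rw [map_sub, sub_ne_zero] at this
        simpa using this)
    filter_upwards [e1, e2] with q h1 h2 using and_congr h1 h2

/-! ### The expected number of pairs with a void region -/

/-- The number of pairs `(u, w)` of points of `S`, with `u` in `A` and `w` in `W`, such that `w`
lies in the sector with apex `u` and no point of `S` lies in the region `R u w`. -/
noncomputable def voidPairCount (φ : ℂ ≃L[ℝ] ℝ × ℝ) (R : ℂ → ℂ → Set ℂ) (A W S : Set ℂ) : ℝ≥0∞ :=
  ({p : ℂ × ℂ | p.1 ∈ S ∩ A ∧ p.2 ∈ S ∩ W ∧ p.2 - p.1 ∈ sector φ ∧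
    S ∩ R p.1 p.2 = ∅}.encard : ℝ≥0∞)

/-- The indicator of the event that the set `E` contains no point of `S`. -/
noncomputable def voidIndicator (S E : Set ℂ) : ℝ≥0∞ := Set.indicator {0} 1 (S ∩ E).encard

/-- The probability that the set `E` contains no point of a unit Poisson process. -/
noncomputable def voidProb (E : Set ℂ) : ℝ≥0∞ := ENNReal.ofReal (Real.exp (-(volume E).toReal))

open Classical in
/-- The value `V (R u w)` of a set function at the region of `u` and `w`, if `w` lies in the sector
with apex `u`. -/
noncomputable def pairWeight (φ : ℂ ≃L[ℝ] ℝ × ℝ) (V : Set ℂ → ℝ≥0∞) (R : ℂ → ℂ → Set ℂ)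
    (u w : ℂ) : ℝ≥0∞ := if w - u ∈ sector φ then V (R u w) else 0

/-- The region of the points `p` and `q`, which represent two cells of `s`, without these cells. -/
def cellRegion (R : ℂ → ℂ → Set ℂ) (s : SimpleFunc ℂ ℂ) (p q : ℂ) : Set ℂ :=
  R p q \ (s ⁻¹' {p} ∪ s ⁻¹' {q})

/-- The weight of a pair of distinct cells, with the two cells removed from the region. -/
noncomputable def cellWeight (φ : ℂ ≃L[ℝ] ℝ × ℝ) (V : Set ℂ → ℝ≥0∞) (R : ℂ → ℂ → Set ℂ)
    (s : SimpleFunc ℂ ℂ) (p q : ℂ) : ℝ≥0∞ :=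
  if p = q then 0 else pairWeight φ V (fun p q => cellRegion R s p q) p q

lemma voidIndicator_le_one (S E : Set ℂ) : voidIndicator S E ≤ 1 :=
  Set.indicator_le_self _ _ _

lemma voidIndicator_eq_ite (S E : Set ℂ) [Decidable (S ∩ E = ∅)] :
    voidIndicator S E = if S ∩ E = ∅ then 1 else 0 := by
  by_cases h : S ∩ E = ∅ <;> simp [voidIndicator, h]

lemma voidProb_le_one (E : Set ℂ) : voidProb E ≤ 1 := by
  rw [voidProb, ENNReal.ofReal_le_one, Real.exp_le_one_iff]
  simp

lemma cellWeight_le_one (φ : ℂ ≃L[ℝ] ℝ × ℝ) {V : Set ℂ → ℝ≥0∞} (hV : ∀ E, V E ≤ 1)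
    (R : ℂ → ℂ → Set ℂ) (s : SimpleFunc ℂ ℂ) (p q : ℂ) : cellWeight φ V R s p q ≤ 1 := by
  unfold cellWeight pairWeight
  split_ifs
  · exact zero_le
  · exact hV _
  · exact zero_le

lemma voidPairCount_eq_lintegral {φ : ℂ ≃L[ℝ] ℝ × ℝ} {R : ℂ → ℂ → Set ℂ} {A W S : Set ℂ}
    (hA : (S ∩ A).Finite) (hW : (S ∩ W).Finite) :
    voidPairCount φ R A W S =
      ∫⁻ u, ∫⁻ w, pairWeight φ (voidIndicator S) R u w ∂(Measure.count.restrict (S ∩ W))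
        ∂(Measure.count.restrict (S ∩ A)) := by
  classical
  have hA' : S ∩ A = (hA.toFinset : Set ℂ) := by simp
  have hW' : S ∩ W = (hW.toFinset : Set ℂ) := by simp
  rw [hA', hW']
  simp only [lintegral_finset, Measure.count_singleton, mul_one]
  have hset : {p : ℂ × ℂ | p.1 ∈ S ∩ A ∧ p.2 ∈ S ∩ W ∧ p.2 - p.1 ∈ sector φ ∧
      S ∩ R p.1 p.2 = ∅} = ((hA.toFinset ×ˢ hW.toFinset).filter
        fun p : ℂ × ℂ => p.2 - p.1 ∈ sector φ ∧ S ∩ R p.1 p.2 = ∅ : Finset (ℂ × ℂ)) := by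
    ext p
    simp [and_assoc]
  rw [voidPairCount, hset, Set.encard_coe_eq_coe_finsetCard, ENat.toENNReal_coe,
    Finset.card_filter,
    Finset.sum_product]
  push_cast
  refine Finset.sum_congr rfl fun u _ => Finset.sum_congr rfl fun w _ => ?_
  rw [pairWeight, voidIndicator_eq_ite, ite_and]

lemma measurableSet_cellRegion {φ : ℂ ≃L[ℝ] ℝ × ℝ} {R : ℂ → ℂ → Set ℂ} (hR : IsStableRegion φ R)
    (s : SimpleFunc ℂ ℂ) (p q : ℂ) : MeasurableSet (cellRegion R s p q) :=
  (hR.measurableSet p q).diff ((s.measurableSet_preimage _).union (s.measurableSet_preimage _))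

section Limits

variable {φ : ℂ ≃L[ℝ] ℝ × ℝ} {R : ℂ → ℂ → Set ℂ} {s : ℕ → SimpleFunc ℂ ℂ}

lemma eventually_mem_cellRegion_iff (hR : IsStableRegion φ R)
    (hs : ∀ z, Tendsto (fun n => s n z) atTop (𝓝 z)) {u w v : ℂ} (huw : InGeneralPosition φ u w)
    (hu : InGeneralPosition φ v u) (hw : InGeneralPosition φ v w) :
    ∀ᶠ n in atTop, (v ∈ cellRegion R (s n) (s n u) (s n w) ↔ v ∈ R u w) := by
  filter_upwards [((hs u).prodMk_nhds (hs w)).eventually (hR.eventually_mem_iff u w v huw hu hw),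
    eventually_ne_of_tendsto (f := id) hs hu.ne, eventually_ne_of_tendsto (f := id) hs hw.ne]
    with n h1 h2 h3
  simp [cellRegion, h1, h2, h3]

lemma eventually_cellRegion_subset (hR : IsStableRegion φ R)
    (hs : ∀ z, Tendsto (fun n => s n z) atTop (𝓝 z)) (u w : ℂ) : ∃ r : ℝ,
    R u w ⊆ Metric.closedBall 0 r ∧
    ∀ᶠ n in atTop, cellRegion R (s n) (s n u) (s n w) ⊆ Metric.closedBall 0 r := by
  obtain ⟨r, hr⟩ := hR.exists_bounded u w
  refine ⟨r, hr.self_of_nhds, ?_⟩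
  filter_upwards [((hs u).prodMk_nhds (hs w)).eventually hr] with n hn
  exact Set.sdiff_subset.trans hn

lemma tendsto_cellWeight (hs : ∀ z, Tendsto (fun n => s n z) atTop (𝓝 z)) {V : Set ℂ → ℝ≥0∞}
    {u w : ℂ} (huw : InGeneralPosition φ u w)
    (hV : Tendsto (fun n => V (cellRegion R (s n) (s n u) (s n w))) atTop (𝓝 (V (R u w)))) :
    Tendsto (fun n => cellWeight φ V R (s n) (s n u) (s n w)) atTop (𝓝 (pairWeight φ V R u w)) := by
  have h1 := ((hs u).prodMk_nhds (hs w)).eventually (eventually_mem_sector_iff φ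
    (f := fun q : ℂ × ℂ => q.2 - q.1) (x := (u, w)) (by fun_prop) huw.symm.1 huw.symm.2.1)
  have h2 := eventually_ne_of_tendsto (f := id) hs huw.ne
  by_cases h : w - u ∈ sector φ
  · rw [pairWeight, if_pos h]
    refine hV.congr' ?_
    filter_upwards [h1, h2] with n h1 h2
    rw [cellWeight, if_neg h2, pairWeight, if_pos (h1.2 h)]
  · rw [pairWeight, if_neg h]
    refine tendsto_const_nhds.congr' ?_
    filter_upwards [h1, h2] with n h1 h2
    rw [cellWeight, if_neg h2, pairWeight, if_neg (mt h1.1 h)]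

lemma tendsto_voidProb_cellRegion (hR : IsStableRegion φ R)
    (hs : ∀ z, Tendsto (fun n => s n z) atTop (𝓝 z)) {u w : ℂ} (huw : InGeneralPosition φ u w) :
    Tendsto (fun n => voidProb (cellRegion R (s n) (s n u) (s n w))) atTop
      (𝓝 (voidProb (R u w))) := by
  obtain ⟨r, hr, hr'⟩ := eventually_cellRegion_subset hR hs u w
  have h := tendsto_measure_of_ae_tendsto_indicator (μ := volume) atTop (hR.measurableSet u w)
    (fun n => measurableSet_cellRegion hR (s n) (s n u) (s n w))
    Metric.isClosed_closedBall.measurableSet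
    (measure_closedBall_lt_top (x := (0 : ℂ)) (r := r)).ne hr' (by
      filter_upwards [ae_inGeneralPosition φ u, ae_inGeneralPosition φ w] with v hu hw
      exact eventually_mem_cellRegion_iff hR hs huw hu.symm hw.symm)
  have h' := (ENNReal.tendsto_toReal (hR.volume_ne_top u w)).comp h
  exact (ENNReal.continuous_ofReal.tendsto _).comp ((Real.continuous_exp.tendsto _).comp h'.neg)

lemma tendsto_voidIndicator_cellRegion (hR : IsStableRegion φ R)
    (hs : ∀ z, Tendsto (fun n => s n z) atTop (𝓝 z)) {S : Set ℂ}
    (hS : ∀ A, Bornology.IsBounded A → (S ∩ A).Finite) (hgen : S.Pairwise (InGeneralPosition φ))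
    {u w : ℂ} (hu : u ∈ S) (hw : w ∈ S) (huw : u ≠ w) :
    Tendsto (fun n => voidIndicator S (cellRegion R (s n) (s n u) (s n w))) atTop
      (𝓝 (voidIndicator S (R u w))) := by
  obtain ⟨r, hr, hr'⟩ := eventually_cellRegion_subset hR hs u w
  have hfin := hS _ (Metric.isBounded_closedBall (x := (0 : ℂ)) (r := r))
  -- only the finitely many points of `S` in a fixed ball matter
  have hall : ∀ᶠ n in atTop, ∀ v ∈ S ∩ Metric.closedBall 0 r,
      (v ∈ cellRegion R (s n) (s n u) (s n w) ↔ v ∈ R u w) := by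
    rw [eventually_all_finite hfin]
    rintro v ⟨hv, -⟩
    rcases eq_or_ne v u with rfl | hvu
    · exact .of_forall fun n => by simp [cellRegion, hR.left_notMem]
    rcases eq_or_ne v w with rfl | hvw
    · exact .of_forall fun n => by simp [cellRegion, hR.right_notMem]
    exact eventually_mem_cellRegion_iff hR hs (hgen hu hw huw) (hgen hv hu hvu) (hgen hv hw hvw)
  refine tendsto_const_nhds.congr' ?_
  filter_upwards [hall, hr'] with n hn hn'
  have : S ∩ R u w = S ∩ cellRegion R (s n) (s n u) (s n w) := by
    ext v
    constructor
    · rintro ⟨hv, hvR⟩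
      exact ⟨hv, (hn v ⟨hv, hr hvR⟩).2 hvR⟩
    · rintro ⟨hv, hvR⟩
      exact ⟨hv, (hn v ⟨hv, hn' hvR⟩).1 hvR⟩
  rw [voidIndicator, voidIndicator, this]

end Limits

section PoissonCounts

variable {Ω : Type*} [MeasurableSpace Ω] {P : Measure Ω} {Φ : Ω → Set ℂ}
  {φ : ℂ ≃L[ℝ] ℝ × ℝ} {R : ℂ → ℂ → Set ℂ}

/-- The discretized pair count, a double integral over the point set with each point moved to the
representative of its cell, is a sum over the pairs of cells. -/
lemma lintegral_count_cellWeight (hΦ : IsUnitPoissonProcess P Φ) {A W : Set ℂ}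
    (hA : Bornology.IsBounded A) (hW : Bornology.IsBounded W) (s : SimpleFunc ℂ ℂ) (ω : Ω) :
    ∫⁻ u, ∫⁻ w, cellWeight φ (voidIndicator (Φ ω)) R s (s u) (s w)
        ∂(Measure.count.restrict (Φ ω ∩ W)) ∂(Measure.count.restrict (Φ ω ∩ A)) =
      ∑ p ∈ s.range, ∑ q ∈ s.range, cellWeight φ (voidIndicator (Φ ω)) R s p q *
        (((Φ ω ∩ (s ⁻¹' {p} ∩ A)).encard : ℝ≥0∞) * (Φ ω ∩ (s ⁻¹' {q} ∩ W)).encard) := by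
  rw [← sum_sum_measure_preimage_eq_lintegral]
  simp only [count_restrict_apply (hΦ.locallyFinite ω _ hA) (s.measurableSet_preimage _),
    count_restrict_apply (hΦ.locallyFinite ω _ hW) (s.measurableSet_preimage _),
    Set.inter_left_comm]

lemma measurable_cellWeight (hΦ : IsUnitPoissonProcess P Φ) (hR : IsStableRegion φ R)
    (s : SimpleFunc ℂ ℂ) (p q : ℂ) :
    Measurable fun ω => cellWeight φ (voidIndicator (Φ ω)) R s p q := by
  unfold cellWeight pairWeight
  split_ifs
  · exact measurable_const
  · exact (Measurable.of_discrete (f := Set.indicator {(0 : ℕ∞)} (1 : ℕ∞ → ℝ≥0∞))).comp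
      (hΦ.measurable_count _ (measurableSet_cellRegion hR s p q))
  · exact measurable_const

variable [IsProbabilityMeasure P]

/-- The expectation of a single term of the discretized pair count. The removal of the two cells
from the region makes the three sets disjoint. -/
lemma lintegral_cellWeight_mul (hΦ : IsUnitPoissonProcess P Φ) (hR : IsStableRegion φ R)
    {A W : Set ℂ} (hA : MeasurableSet A) (hW : MeasurableSet W) (hA' : volume A ≠ ∞)
    (hW' : volume W ≠ ∞) (s : SimpleFunc ℂ ℂ) (p q : ℂ) :
    ∫⁻ ω, cellWeight φ (voidIndicator (Φ ω)) R s p q *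
        (((Φ ω ∩ (s ⁻¹' {p} ∩ A)).encard : ℝ≥0∞) * (Φ ω ∩ (s ⁻¹' {q} ∩ W)).encard) ∂P =
      cellWeight φ voidProb R s p q * (volume (s ⁻¹' {p} ∩ A) * volume (s ⁻¹' {q} ∩ W)) := by
  unfold cellWeight pairWeight
  split_ifs with hpq hsec
  · simp
  · have hd : Disjoint (s ⁻¹' {p}) (s ⁻¹' {q}) :=
      Disjoint.preimage _ (Set.disjoint_singleton.2 hpq)
    have hdp : Disjoint (s ⁻¹' {p}) (cellRegion R s p q) :=
      (Set.disjoint_sdiff_left.mono_right Set.subset_union_left).symm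
    have hdq : Disjoint (s ⁻¹' {q}) (cellRegion R s p q) :=
      (Set.disjoint_sdiff_left.mono_right Set.subset_union_right).symm
    have h := hΦ.lintegral_encard_mul_encard_mul_void
      ((s.measurableSet_preimage {p}).inter hA) ((s.measurableSet_preimage {q}).inter hW)
      (measurableSet_cellRegion hR s p q)
      (measure_ne_top_of_subset Set.inter_subset_right hA')
      (measure_ne_top_of_subset Set.inter_subset_right hW')
      (measure_ne_top_of_subset Set.sdiff_subset (hR.volume_ne_top p q))
      (hd.mono Set.inter_subset_left Set.inter_subset_left) (hdp.mono_left Set.inter_subset_left)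
      (hdq.mono_left Set.inter_subset_left)
    simpa only [mul_comm, mul_assoc, mul_left_comm, voidProb, voidIndicator] using h
  · simp

/-- In bounded windows the expected number of pairs with a void region is the integral of the void
probabilities (a bivariate Mecke formula). Both sides are limits of their discretized versions, for
which the formula follows from the independence of the counts in disjoint sets. -/
lemma lintegral_voidPairCount_of_isBounded (hΦ : IsUnitPoissonProcess P Φ)
    (hR : IsStableRegion φ R) {A W : Set ℂ} (hA : MeasurableSet A) (hW : MeasurableSet W)
    (hAb : Bornology.IsBounded A) (hWb : Bornology.IsBounded W) :
    AEMeasurable (fun ω => voidPairCount φ R A W (Φ ω)) P ∧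
      ∫⁻ ω, voidPairCount φ R A W (Φ ω) ∂P =
        ∫⁻ u in A, ∫⁻ w in W, pairWeight φ voidProb R u w := by
  set s : ℕ → SimpleFunc ℂ ℂ := (stronglyMeasurable_id (α := ℂ)).approx
  have hs : ∀ z, Tendsto (fun n => s n z) atTop (𝓝 z) :=
    (stronglyMeasurable_id (α := ℂ)).tendsto_approx
  have hA' : volume A ≠ ∞ := hAb.measure_lt_top.ne
  have hW' : volume W ≠ ∞ := hWb.measure_lt_top.ne
  set X : ℕ → Ω → ℝ≥0∞ := fun n ω => ∫⁻ u, ∫⁻ w,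
    cellWeight φ (voidIndicator (Φ ω)) R (s n) (s n u) (s n w)
      ∂(Measure.count.restrict (Φ ω ∩ W)) ∂(Measure.count.restrict (Φ ω ∩ A))
  have hX : ∀ n, X n = fun ω => ∑ p ∈ (s n).range, ∑ q ∈ (s n).range,
      cellWeight φ (voidIndicator (Φ ω)) R (s n) p q * (((Φ ω ∩ (s n ⁻¹' {p} ∩ A)).encard : ℝ≥0∞) *
        (Φ ω ∩ (s n ⁻¹' {q} ∩ W)).encard) :=
    fun n => funext fun ω => lintegral_count_cellWeight hΦ hAb hWb (s n) ω
  have hterm : ∀ n p q, Measurable fun ω => cellWeight φ (voidIndicator (Φ ω)) R (s n) p q *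
      (((Φ ω ∩ (s n ⁻¹' {p} ∩ A)).encard : ℝ≥0∞) * (Φ ω ∩ (s n ⁻¹' {q} ∩ W)).encard) :=
    fun n p q => (measurable_cellWeight hΦ hR (s n) p q).mul
      ((hΦ.measurable_toENNReal_encard (((s n).measurableSet_preimage _).inter hA)).mul
        (hΦ.measurable_toENNReal_encard (((s n).measurableSet_preimage _).inter hW)))
  have hXm : ∀ n, Measurable (X n) := fun n => by
    rw [hX]
    exact Finset.measurable_fun_sum _ fun p _ => Finset.measurable_fun_sum _ fun q _ => hterm n p q
  have hXlim : ∀ᵐ ω ∂P, Tendsto (fun n => X n ω) atTop (𝓝 (voidPairCount φ R A W (Φ ω))) := by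
    filter_upwards [hΦ.ae_pairwise_inGeneralPosition φ] with ω hgen
    have hfA := hΦ.locallyFinite ω A hAb
    have hfW := hΦ.locallyFinite ω W hWb
    rw [voidPairCount_eq_lintegral hfA hfW]
    have := isFiniteMeasure_count_restrict hfA
    have := isFiniteMeasure_count_restrict hfW
    refine tendsto_lintegral_lintegral_simpleFunc
      (h := fun n => cellWeight φ (voidIndicator (Φ ω)) R (s n))
      (fun n => cellWeight_le_one φ (voidIndicator_le_one _) R (s n)) ?_
    refine ae_restrict_of_forall_mem hfA.measurableSet fun u hu =>
      ae_restrict_of_forall_mem hfW.measurableSet fun w hw => ?_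
    rcases eq_or_ne u w with rfl | huw
    · simp [cellWeight, pairWeight, zero_notMem_sector]
    · exact tendsto_cellWeight hs (hgen hu.1 hw.1 huw)
        (tendsto_voidIndicator_cellRegion hR hs (hΦ.locallyFinite ω) hgen hu.1 hw.1 huw)
  refine ⟨aemeasurable_of_tendsto_metrizable_ae atTop (fun n => (hXm n).aemeasurable) hXlim, ?_⟩
  have hlim1 : Tendsto (fun n => ∫⁻ ω, X n ω ∂P) atTop
      (𝓝 (∫⁻ ω, voidPairCount φ R A W (Φ ω) ∂P)) := by
    refine tendsto_lintegral_of_dominated_convergence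
      (fun ω => ((Φ ω ∩ A).encard : ℝ≥0∞) ^ 2 + ((Φ ω ∩ W).encard : ℝ≥0∞) ^ 2) hXm
      (fun n => .of_forall fun ω => ?_) ?_ hXlim
    · calc X n ω ≤ ∫⁻ u, ∫⁻ w, 1 ∂(Measure.count.restrict (Φ ω ∩ W))
            ∂(Measure.count.restrict (Φ ω ∩ A)) :=
          lintegral_mono fun u => lintegral_mono fun w =>
            cellWeight_le_one φ (voidIndicator_le_one _) R (s n) _ _
        _ = (Φ ω ∩ W).encard * (Φ ω ∩ A).encard := by
          simp [Measure.count_apply (hΦ.locallyFinite ω A hAb).measurableSet,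
            Measure.count_apply (hΦ.locallyFinite ω W hWb).measurableSet]
        _ ≤ _ := by
          rcases le_total ((Φ ω ∩ W).encard : ℝ≥0∞) (Φ ω ∩ A).encard with h | h
          · exact (mul_le_mul_left h _).trans ((sq _).symm.le.trans le_self_add)
          · exact (mul_le_mul_right h _).trans ((sq _).symm.le.trans le_add_self)
    · rw [lintegral_add_left ((hΦ.measurable_toENNReal_encard hA).pow_const 2)]
      exact (ENNReal.add_lt_top.2 ⟨hΦ.lintegral_encard_sq_lt_top hA hA',
        hΦ.lintegral_encard_sq_lt_top hW hW'⟩).ne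
  have hEX : ∀ n, ∫⁻ ω, X n ω ∂P =
      ∫⁻ u in A, ∫⁻ w in W, cellWeight φ voidProb R (s n) (s n u) (s n w) := by
    intro n
    refine Eq.trans ?_ (sum_sum_measure_preimage_eq_lintegral (s n) (volume.restrict A)
      (volume.restrict W) (cellWeight φ voidProb R (s n)))
    rw [hX, lintegral_finsetSum _ fun p _ => Finset.measurable_fun_sum _ fun q _ => hterm n p q]
    refine Finset.sum_congr rfl fun p _ => ?_
    rw [lintegral_finsetSum _ fun q _ => hterm n p q]
    refine Finset.sum_congr rfl fun q _ => ?_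
    rw [lintegral_cellWeight_mul hΦ hR hA hW hA' hW',
      Measure.restrict_apply ((s n).measurableSet_preimage _),
      Measure.restrict_apply ((s n).measurableSet_preimage _)]
  have : IsFiniteMeasure (volume.restrict A) := ⟨by simpa using hA'.lt_top⟩
  have : IsFiniteMeasure (volume.restrict W) := ⟨by simpa using hW'.lt_top⟩
  have hlim2 := tendsto_lintegral_lintegral_simpleFunc (s := s) (μ := volume.restrict A)
    (ν := volume.restrict W) (h := fun n => cellWeight φ voidProb R (s n))
    (g := pairWeight φ voidProb R)
    (fun n => cellWeight_le_one φ voidProb_le_one R (s n)) (.of_forall fun u =>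
      ae_restrict_of_ae <| by
        filter_upwards [ae_inGeneralPosition φ u] with w hw
        exact tendsto_cellWeight hs hw (tendsto_voidProb_cellRegion hR hs hw))
  exact tendsto_nhds_unique (hlim1.congr hEX) hlim2

end PoissonCounts

lemma toENNReal_encard_iUnion_of_monotone {X : Type*} {s : ℕ → Set X} (hs : Monotone s) :
    ((⋃ n, s n).encard : ℝ≥0∞) = ⨆ n, ((s n).encard : ℝ≥0∞) := by
  let _ : MeasurableSpace X := ⊤
  have h : ∀ t : Set X, (t.encard : ℝ≥0∞) = Measure.count t := fun t =>
    (Measure.count_apply MeasurableSpace.measurableSet_top).symm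
  simp only [h]
  exact hs.measure_iUnion

/-- The expected number of pairs with a void region and first point in `B`, when the void
probability of the region of `u` and `w` depends only on `w - u`. -/
lemma IsUnitPoissonProcess.lintegral_voidPairCount {Ω : Type*} [MeasurableSpace Ω] {P : Measure Ω}
    [IsProbabilityMeasure P] {Φ : Ω → Set ℂ} {φ : ℂ ≃L[ℝ] ℝ × ℝ} {R : ℂ → ℂ → Set ℂ}
    (hΦ : IsUnitPoissonProcess P Φ) (hR : IsStableRegion φ R) {g : ℂ → ℝ≥0∞} (hg : Measurable g)
    (hRg : ∀ u w, pairWeight φ voidProb R u w = g (w - u)) {B : Set ℂ} (hB : MeasurableSet B) :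
    AEMeasurable (fun ω => voidPairCount φ R B Set.univ (Φ ω)) P ∧
      ∫⁻ ω, voidPairCount φ R B Set.univ (Φ ω) ∂P = volume B * ∫⁻ z, g z := by
  set W : ℕ → Set ℂ := fun n => Metric.ball 0 n
  have hWm : ∀ n, MeasurableSet (W n) := fun n => measurableSet_ball
  have hWb : ∀ n, Bornology.IsBounded (W n) := fun n => Metric.isBounded_ball
  have hWmono : Monotone W := fun m n h => Metric.ball_subset_ball (by exact_mod_cast h)
  have hWU : ⋃ n, W n = Set.univ := Metric.iUnion_ball_nat 0
  have hbd := fun n => lintegral_voidPairCount_of_isBounded hΦ hR (hB.inter (hWm n)) (hWm n)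
    ((hWb n).subset Set.inter_subset_right) (hWb n)
  set T : Ω → ℕ → Set (ℂ × ℂ) := fun ω n => {p : ℂ × ℂ | p.1 ∈ Φ ω ∩ (B ∩ W n) ∧
    p.2 ∈ Φ ω ∩ W n ∧ p.2 - p.1 ∈ sector φ ∧ Φ ω ∩ R p.1 p.2 = ∅}
  have hTmono : ∀ ω, Monotone (T ω) := by
    rintro ω m n h p ⟨⟨h1, h2, h3⟩, ⟨h4, h5⟩, h6⟩
    exact ⟨⟨h1, h2, hWmono h h3⟩, ⟨h4, hWmono h h5⟩, h6⟩
  have hsup : ∀ ω, voidPairCount φ R B Set.univ (Φ ω) =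
      ⨆ n, voidPairCount φ R (B ∩ W n) (W n) (Φ ω) := by
    intro ω
    refine Eq.trans ?_ (toENNReal_encard_iUnion_of_monotone (hTmono ω))
    rw [voidPairCount]
    congr 2
    ext p
    simp only [Set.mem_iUnion, Set.mem_ofPred_eq, Set.mem_inter_iff, Set.mem_univ, and_true]
    constructor
    · rintro ⟨⟨h1, h2⟩, h3, h4⟩
      obtain ⟨m, hm⟩ := Set.mem_iUnion.1 (hWU ▸ Set.mem_univ p.1)
      obtain ⟨n, hn⟩ := Set.mem_iUnion.1 (hWU ▸ Set.mem_univ p.2)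
      exact ⟨max m n, ⟨h1, h2, hWmono (le_max_left _ _) hm⟩,
        ⟨h3, hWmono (le_max_right _ _) hn⟩, h4⟩
    · rintro ⟨n, ⟨h1, h2, -⟩, ⟨h3, -⟩, h4⟩
      exact ⟨⟨h1, h2⟩, h3, h4⟩
  have hmono : ∀ ω, Monotone fun n => voidPairCount φ R (B ∩ W n) (W n) (Φ ω) :=
    fun ω m n h => ENat.toENNReal_le.2 (Set.encard_le_encard (hTmono ω h))
  simp only [hsup]
  refine ⟨AEMeasurable.iSup fun n => (hbd n).1, ?_⟩
  rw [lintegral_iSup' (fun n => (hbd n).1) (.of_forall hmono)]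
  have hg2 : Measurable fun z : ℂ × ℂ => g (z.2 - z.1) :=
    hg.comp (measurable_snd.sub measurable_fst)
  have hprod : ∀ A V : Set ℂ, ∫⁻ u in A, ∫⁻ w in V, g (w - u) =
      ∫⁻ z in A ×ˢ V, g (z.2 - z.1) ∂(volume.prod volume) := by
    intro A V
    rw [← Measure.prod_restrict, lintegral_prod _ hg2.aemeasurable]
  have hunion : ⋃ n, (B ∩ W n) ×ˢ W n = B ×ˢ Set.univ := by
    rw [Set.iUnion_prod_of_monotone (fun m n h => Set.inter_subset_inter_right B (hWmono h))
      hWmono, ← Set.inter_iUnion, hWU, Set.inter_univ]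
  simp only [(hbd _).2, hRg, hprod]
  rw [← setLIntegral_iUnion_of_directed _ (Monotone.directed_le fun m n h =>
    Set.prod_mono (Set.inter_subset_inter_right B (hWmono h)) (hWmono h)), hunion, ← hprod]
  simp [lintegral_sub_right_eq_self, mul_comm]

/-! ### Areas of the triangles -/

/-- Linear coordinates scale areas by a constant factor. -/
lemma exists_map_volume_eq_smul (φ : ℂ ≃L[ℝ] ℝ × ℝ) :
    ∃ c : ℝ≥0, 0 < c ∧ (volume : Measure ℂ).map φ = (c : ℝ≥0∞) • volume := by
  have : ((volume : Measure ℂ).map φ).IsAddHaarMeasure := φ.isAddHaarMeasure_map _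
  exact ⟨_, Measure.addHaarScalarFactor_pos_of_isAddHaarMeasure _ _,
    Measure.isAddLeftInvariant_eq_smul _ volume⟩

/-- The half-open standard triangle of size `t`. -/
def quadrantTriangle (t : ℝ) : Set (ℝ × ℝ) := {x | (0 < x.1 ∧ 0 ≤ x.2) ∧ x.1 + x.2 < t}

lemma measurableSet_quadrantTriangle (t : ℝ) : MeasurableSet (quadrantTriangle t) :=
  ((measurableSet_lt measurable_const measurable_fst).inter
    (measurableSet_le measurable_const measurable_snd)).inter
    (measurableSet_lt (measurable_fst.add measurable_snd) measurable_const)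

lemma lintegral_Ioi_ofReal_of_hasDerivAt {g g' : ℝ → ℝ} {a l : ℝ}
    (hderiv : ∀ x ∈ Set.Ici a, HasDerivAt g (g' x) x) (hpos : ∀ x ∈ Set.Ioi a, 0 ≤ g' x)
    (hlim : Tendsto g atTop (𝓝 l)) :
    ∫⁻ x in Set.Ioi a, ENNReal.ofReal (g' x) = ENNReal.ofReal (l - g a) := by
  rw [← integral_Ioi_of_hasDerivAt_of_nonneg' hderiv hpos hlim,
    ofReal_integral_eq_lintegral_ofReal (integrableOn_Ioi_deriv_of_nonneg' hderiv hpos hlim)]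
  exact ae_restrict_of_forall_mem measurableSet_Ioi hpos

lemma volume_quadrantTriangle {t : ℝ} (ht : 0 ≤ t) :
    volume (quadrantTriangle t) = ENNReal.ofReal (t ^ 2 / 2) := by
  rw [Measure.volume_eq_prod, Measure.prod_apply (measurableSet_quadrantTriangle t)]
  have hslice : ∀ x : ℝ, volume (Prod.mk x ⁻¹' quadrantTriangle t) =
      (Set.Ioc 0 t).indicator (fun x => ENNReal.ofReal (t - x)) x := by
    intro x
    by_cases hx : 0 < x
    · have : Prod.mk x ⁻¹' quadrantTriangle t = Set.Ico 0 (t - x) := by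
        ext y
        simp [quadrantTriangle, hx, lt_sub_iff_add_lt']
      rw [this, Real.volume_Ico, sub_zero]
      by_cases hxt : x ≤ t
      · simp [hx, hxt]
      · simp [hxt, (not_le.1 hxt).le]
    · have : Prod.mk x ⁻¹' quadrantTriangle t = ∅ := by
        ext y
        simp [quadrantTriangle, hx]
      simp [this, hx]
  simp only [hslice]
  rw [lintegral_indicator measurableSet_Ioc, ← ofReal_integral_eq_lintegral_ofReal,
    ← intervalIntegral.integral_of_le ht]
  · congr 1
    rw [intervalIntegral.integral_sub (by simp) (by simp), intervalIntegral.integral_const,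
      integral_id, smul_eq_mul]
    ring
  · exact (by fun_prop : Continuous fun x : ℝ => t - x).integrableOn_Ioc
  · exact ae_restrict_of_forall_mem measurableSet_Ioc fun x hx => sub_nonneg.2 hx.2

lemma level_nonneg {φ : ℂ ≃L[ℝ] ℝ × ℝ} {z : ℂ} (h : z ∈ sector φ) : 0 ≤ level φ z :=
  add_nonneg h.1.le h.2

section Areas

variable {φ : ℂ ≃L[ℝ] ℝ × ℝ} {c : ℝ≥0}

lemma volume_preimage_coords (hc : (volume : Measure ℂ).map φ = (c : ℝ≥0∞) • volume)
    {E : Set (ℝ × ℝ)} (hE : MeasurableSet E) (u : ℂ) :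
    volume {v | φ (v - u) ∈ E} = c * volume E := by
  have h : volume (φ ⁻¹' E) = c * volume E := by
    rw [← Measure.map_apply φ.continuous.measurable hE, hc, Measure.smul_apply, smul_eq_mul]
  rw [← h]
  exact (measurePreserving_sub_right volume u).measure_preimage
    (φ.continuous.measurable hE).nullMeasurableSet

lemma forwardTriangle_eq (u w : ℂ) :
    forwardTriangle φ u w = {v | φ (v - u) ∈ quadrantTriangle (level φ (w - u))} := rfl

lemma backwardTriangle_eq (u w : ℂ) :
    backwardTriangle φ u w =
      {v | φ (v - u) ∈ (fun x => φ (w - u) - x) ⁻¹' quadrantTriangle (level φ (w - u))} := by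
  ext v
  simp only [Set.mem_ofPred_eq, Set.mem_preimage, ← map_sub, sub_sub_sub_cancel_right]
  rfl

lemma measurableSet_reflect_quadrantTriangle (p : ℝ × ℝ) (t : ℝ) :
    MeasurableSet ((fun x => p - x) ⁻¹' quadrantTriangle t) :=
  (measurable_id.const_sub p) (measurableSet_quadrantTriangle t)

lemma volume_reflect_quadrantTriangle (p : ℝ × ℝ) (t : ℝ) :
    volume ((fun x => p - x) ⁻¹' quadrantTriangle t) = volume (quadrantTriangle t) :=
  (Measure.measurePreserving_sub_left volume p).measure_preimage
    (measurableSet_quadrantTriangle t).nullMeasurableSet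

lemma volume_forwardTriangle (hc : (volume : Measure ℂ).map φ = (c : ℝ≥0∞) • volume) {u w : ℂ}
    (h : w - u ∈ sector φ) :
    volume (forwardTriangle φ u w) = ENNReal.ofReal (c * (level φ (w - u) ^ 2 / 2)) := by
  rw [forwardTriangle_eq, volume_preimage_coords hc (measurableSet_quadrantTriangle _),
    volume_quadrantTriangle (level_nonneg h), ENNReal.ofReal_mul c.coe_nonneg,
    ENNReal.ofReal_coe_nnreal]

lemma volume_backwardTriangle (hc : (volume : Measure ℂ).map φ = (c : ℝ≥0∞) • volume) {u w : ℂ}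
    (h : w - u ∈ sector φ) :
    volume (backwardTriangle φ u w) = ENNReal.ofReal (c * (level φ (w - u) ^ 2 / 2)) := by
  rw [backwardTriangle_eq, volume_preimage_coords hc (measurableSet_reflect_quadrantTriangle _ _),
    volume_reflect_quadrantTriangle, volume_quadrantTriangle (level_nonneg h),
    ENNReal.ofReal_mul c.coe_nonneg, ENNReal.ofReal_coe_nnreal]

/-- The two triangles of `u` and `w` overlap in a parallelogram with opposite corners `u` and `w`,
a rectangle in the coordinates `φ`. -/
lemma volume_forwardTriangle_union_backwardTriangle
    (hc : (volume : Measure ℂ).map φ = (c : ℝ≥0∞) • volume) {u w : ℂ} (h : w - u ∈ sector φ) :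
    volume (forwardTriangle φ u w ∪ backwardTriangle φ u w) =
      ENNReal.ofReal (c * (level φ (w - u) ^ 2 - (φ (w - u)).1 * (φ (w - u)).2)) := by
  set p := φ (w - u)
  set t := level φ (w - u)
  have hp1 : 0 < p.1 := h.1
  have hp2 : 0 ≤ p.2 := h.2
  have ht : t = p.1 + p.2 := level_apply φ _
  have hinter : quadrantTriangle t ∩ (fun x => p - x) ⁻¹' quadrantTriangle t =
      Set.Ioo 0 p.1 ×ˢ Set.Icc 0 p.2 := by
    ext ⟨x, y⟩
    simp only [quadrantTriangle, ht, Set.mem_inter_iff, Set.mem_ofPred_eq, Set.mem_preimage,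
      Prod.fst_sub, Prod.snd_sub, Set.mem_prod, Set.mem_Ioo, Set.mem_Icc]
    constructor
    · rintro ⟨⟨⟨h1, h2⟩, h3⟩, ⟨h4, h5⟩, h6⟩
      exact ⟨⟨h1, by linarith⟩, h2, by linarith⟩
    · rintro ⟨⟨h1, h2⟩, h3, h4⟩
      exact ⟨⟨⟨h1, h3⟩, by linarith⟩, ⟨by linarith, by linarith⟩, by linarith⟩
  have hadd := measure_union_add_inter (μ := volume) (quadrantTriangle t)
    (measurableSet_reflect_quadrantTriangle p t)
  rw [hinter, Measure.volume_eq_prod, Measure.prod_prod, Real.volume_Ioo, Real.volume_Icc,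
    ← Measure.volume_eq_prod, volume_reflect_quadrantTriangle, sub_zero, sub_zero,
    volume_quadrantTriangle (by linarith : 0 ≤ t), ← ENNReal.ofReal_mul hp1.le,
    ← ENNReal.ofReal_add (by positivity) (by positivity)] at hadd
  have hunion := ENNReal.eq_sub_of_add_eq ENNReal.ofReal_ne_top hadd
  rw [← ENNReal.ofReal_sub _ (by positivity)] at hunion
  have hset : forwardTriangle φ u w ∪ backwardTriangle φ u w = {v | φ (v - u) ∈
      quadrantTriangle t ∪ (fun x => p - x) ⁻¹' quadrantTriangle t} := by
    rw [forwardTriangle_eq, backwardTriangle_eq]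
    rfl
  rw [hset, volume_preimage_coords hc ((measurableSet_quadrantTriangle t).union
    (measurableSet_reflect_quadrantTriangle p t)), hunion, ENNReal.ofReal_mul c.coe_nonneg,
    ENNReal.ofReal_coe_nnreal]
  congr 3
  ring

end Areas

/-! ### Integrals of the void probabilities -/

lemma lintegral_Ioi_mul_exp_neg_mul_sq {k : ℝ} (hk : 0 < k) :
    ∫⁻ x in Set.Ioi (0 : ℝ), ENNReal.ofReal (x * Real.exp (-(k * x ^ 2))) =
      ENNReal.ofReal (1 / (2 * k)) := by
  have hd : ∀ x ∈ Set.Ici (0 : ℝ), HasDerivAt (fun x => -(1 / (2 * k)) * Real.exp (-(k * x ^ 2)))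
      (x * Real.exp (-(k * x ^ 2))) x := by
    intro x _
    have h1 : HasDerivAt (fun x : ℝ => -(k * x ^ 2)) (-(k * (2 * x))) x := by
      refine ((hasDerivAt_pow 2 x).const_mul k).fun_neg.congr_deriv ?_
      simp
    refine (h1.exp.const_mul (-(1 / (2 * k)))).congr_deriv ?_
    field_simp
  have hlim : Tendsto (fun x => -(1 / (2 * k)) * Real.exp (-(k * x ^ 2))) atTop (𝓝 0) := by
    have : Tendsto (fun x : ℝ => k * x ^ 2) atTop atTop :=
      (tendsto_pow_atTop two_ne_zero).const_mul_atTop hk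
    simpa using (Real.tendsto_exp_neg_atTop_nhds_zero.comp this).const_mul (-(1 / (2 * k)))
  rw [lintegral_Ioi_ofReal_of_hasDerivAt hd
    (fun x hx => mul_nonneg (le_of_lt hx) (Real.exp_nonneg _)) hlim]
  simp

lemma lintegral_Ioi_comp_mul_left (f : ℝ → ℝ≥0∞) {a : ℝ} (ha : 0 < a) :
    ∫⁻ y in Set.Ioi 0, f y = ∫⁻ t in Set.Ioi 0, ENNReal.ofReal a * f (a * t) := by
  have himg : (fun t => a * t) '' Set.Ioi 0 = Set.Ioi 0 := by
    simpa using Set.image_mul_left_Ioi ha 0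
  have h := lintegral_image_eq_lintegral_abs_deriv_mul (s := Set.Ioi (0 : ℝ)) measurableSet_Ioi
    (f := fun t => a * t) (f' := fun _ => a)
    (fun x _ => by simpa using ((hasDerivAt_id x).const_mul a).hasDerivWithinAt)
    (mul_right_injective₀ ha.ne').injOn f
  rw [himg, abs_of_pos ha] at h
  exact h

/-- In the coordinates `x` and `t = y / x` the integral of a Gaussian of a quadratic form over the
quadrant reduces to a one-dimensional rational integral. -/
lemma lintegral_quadrant_exp_neg {c : ℝ} (hc : 0 < c) {q : ℝ × ℝ → ℝ} (hq : Continuous q)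
    (hhom : ∀ x t, q (x, x * t) = x ^ 2 * q (1, t)) (hpos : ∀ t, 0 < t → 0 < q (1, t)) :
    ENNReal.ofReal c * ∫⁻ x in Set.Ioi (0 : ℝ) ×ˢ Set.Ici (0 : ℝ),
        ENNReal.ofReal (Real.exp (-(c * q x))) =
      ∫⁻ t in Set.Ioi 0, ENNReal.ofReal (1 / (2 * q (1, t))) := by
  have hf : Measurable fun x : ℝ × ℝ => ENNReal.ofReal (Real.exp (-(c * q x))) := by fun_prop
  have h1 : ∫⁻ x in Set.Ioi (0 : ℝ) ×ˢ Set.Ici (0 : ℝ), ENNReal.ofReal (Real.exp (-(c * q x))) =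
      ∫⁻ x in Set.Ioi 0, ∫⁻ t in Set.Ioi 0,
        ENNReal.ofReal (x * Real.exp (-(c * q (1, t) * x ^ 2))) := by
    rw [Measure.volume_eq_prod, setLIntegral_prod _ hf.aemeasurable]
    refine setLIntegral_congr_fun measurableSet_Ioi fun x hx => ?_
    have hx : 0 < x := hx
    change ∫⁻ y in Set.Ici 0, ENNReal.ofReal (Real.exp (-(c * q (x, y)))) = _
    rw [setLIntegral_congr Ioi_ae_eq_Ici.symm, lintegral_Ioi_comp_mul_left _ hx]
    refine lintegral_congr fun t => ?_
    rw [← ENNReal.ofReal_mul hx.le, hhom]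
    ring_nf
  rw [h1, lintegral_lintegral_swap (by fun_prop), ← lintegral_const_mul' _ _ ENNReal.ofReal_ne_top]
  refine setLIntegral_congr_fun measurableSet_Ioi fun t ht => ?_
  have hqt := hpos t ht
  change ENNReal.ofReal c * ∫⁻ x in Set.Ioi 0,
    ENNReal.ofReal (x * Real.exp (-(c * q (1, t) * x ^ 2))) = _
  rw [lintegral_Ioi_mul_exp_neg_mul_sq (by positivity), ← ENNReal.ofReal_mul hc.le]
  congr 1
  field_simp

lemma lintegral_Ioi_inv_one_add_sq :
    ∫⁻ t in Set.Ioi (0 : ℝ), ENNReal.ofReal (1 / (2 * ((1 + t) ^ 2 / 2))) = 1 := by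
  have hd : ∀ t ∈ Set.Ici (0 : ℝ), HasDerivAt (fun t => -(1 + t)⁻¹)
      (1 / (2 * ((1 + t) ^ 2 / 2))) t := by
    intro t ht
    have ht' : (1 + t) ≠ 0 := by have : 0 ≤ t := ht; positivity
    refine (((hasDerivAt_id' t).const_add 1).fun_inv ht').fun_neg.congr_deriv ?_
    field_simp
  have hlim : Tendsto (fun t : ℝ => -(1 + t)⁻¹) atTop (𝓝 0) := by
    simpa using
      (tendsto_inv_atTop_zero.comp (tendsto_atTop_add_const_left _ (1 : ℝ) tendsto_id)).neg
  rw [lintegral_Ioi_ofReal_of_hasDerivAt hd (fun t _ => by positivity) hlim]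
  simp

lemma lintegral_Ioi_inv_one_add_add_sq :
    ∫⁻ t in Set.Ioi (0 : ℝ), ENNReal.ofReal (1 / (2 * ((1 + t) ^ 2 - 1 * t))) =
      ENNReal.ofReal (Real.pi * √3 / 9) := by
  have h3 : √3 ^ 2 = 3 := Real.sq_sqrt (by norm_num)
  have h3' : 0 < √3 := by positivity
  have hpos : ∀ t : ℝ, 0 < (1 + t) ^ 2 - 1 * t := fun t => by nlinarith [sq_nonneg (2 * t + 1)]
  -- completing the square: `4 ((1 + t) ^ 2 - t) = (2 t + 1) ^ 2 + 3`
  have hd : ∀ t ∈ Set.Ici (0 : ℝ), HasDerivAt (fun t => 1 / √3 * Real.arctan ((2 * t + 1) / √3))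
      (1 / (2 * ((1 + t) ^ 2 - 1 * t))) t := by
    intro t _
    have h1 : HasDerivAt (fun t : ℝ => (2 * t + 1) / √3) (2 / √3) t := by
      simpa using (((hasDerivAt_id t).const_mul 2).add_const 1).div_const √3
    refine (h1.arctan.const_mul (1 / √3)).congr_deriv ?_
    have := hpos t
    have h4 : (1 + ((2 * t + 1) / √3) ^ 2) = 4 * ((1 + t) ^ 2 - 1 * t) / 3 := by
      rw [div_pow, h3]; ring
    have h5 : 1 / √3 * (1 / (1 + ((2 * t + 1) / √3) ^ 2) * (2 / √3)) =
        2 / √3 ^ 2 * (1 / (1 + ((2 * t + 1) / √3) ^ 2)) := by field_simp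
    rw [h5, h4, h3]
    field_simp
    norm_num
  have hlim : Tendsto (fun t => 1 / √3 * Real.arctan ((2 * t + 1) / √3)) atTop
      (𝓝 (1 / √3 * (Real.pi / 2))) := by
    have h1 : Tendsto (fun t : ℝ => (2 * t + 1) / √3) atTop atTop :=
      (tendsto_atTop_add_const_right _ 1 (tendsto_id.const_mul_atTop two_pos)).atTop_div_const h3'
    exact ((Real.tendsto_arctan_atTop.mono_right nhdsWithin_le_nhds).comp h1).const_mul _
  rw [lintegral_Ioi_ofReal_of_hasDerivAt hd (fun t _ => by have := hpos t; positivity) hlim]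
  have harc : Real.arctan ((2 * 0 + 1) / √3) = Real.pi / 6 := by
    rw [mul_zero, zero_add, ← Real.tan_pi_div_six]
    exact Real.arctan_tan (by linarith [Real.pi_pos]) (by linarith [Real.pi_pos])
  rw [harc]
  congr 1
  field_simp
  rw [h3]
  ring

/-! ### Expected numbers of pairs with void triangles -/

section PoissonCounts

variable {Ω : Type*} [MeasurableSpace Ω] {P : Measure Ω} [IsProbabilityMeasure P]
  {Φ : Ω → Set ℂ} {φ : ℂ ≃L[ℝ] ℝ × ℝ}

/-- The expected number of pairs with a void region whose area is, in the coordinates `φ`, a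
homogeneous function `q` of degree two of the vector from the first point to the second one. The
factor `c` by which `φ` scales areas cancels. -/
lemma IsUnitPoissonProcess.lintegral_voidPairCount_of_volume_eq {R : ℂ → ℂ → Set ℂ} {c : ℝ≥0}
    (hΦ : IsUnitPoissonProcess P Φ) (hc0 : 0 < c)
    (hc : (volume : Measure ℂ).map φ = (c : ℝ≥0∞) • volume) (hR : IsStableRegion φ R)
    {q : ℝ × ℝ → ℝ} (hq : Continuous q) (hhom : ∀ x t, q (x, x * t) = x ^ 2 * q (1, t))
    (hpos : ∀ t, 0 < t → 0 < q (1, t)) (hnonneg : ∀ z ∈ sector φ, 0 ≤ q (φ z))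
    (hvol : ∀ u w, w - u ∈ sector φ → volume (R u w) = ENNReal.ofReal (c * q (φ (w - u))))
    {B : Set ℂ} (hB : MeasurableSet B) :
    AEMeasurable (fun ω => voidPairCount φ R B Set.univ (Φ ω)) P ∧
      ∫⁻ ω, voidPairCount φ R B Set.univ (Φ ω) ∂P =
        volume B * ∫⁻ t in Set.Ioi 0, ENNReal.ofReal (1 / (2 * q (1, t))) := by
  set Q : Set (ℝ × ℝ) := Set.Ioi 0 ×ˢ Set.Ici 0
  have hQ : MeasurableSet Q := measurableSet_Ioi.prod measurableSet_Ici
  set f : ℝ × ℝ → ℝ≥0∞ := Q.indicator fun x => ENNReal.ofReal (Real.exp (-(c * q x)))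
  have hf : Measurable f := Measurable.indicator (by fun_prop) hQ
  have hg : Measurable fun z => f (φ z) := hf.comp φ.continuous.measurable
  have hRg : ∀ u w, pairWeight φ voidProb R u w = f (φ (w - u)) := by
    intro u w
    by_cases h : w - u ∈ sector φ
    · have h' : φ (w - u) ∈ Q := h
      rw [pairWeight, if_pos h, voidProb, hvol u w h, ENNReal.toReal_ofReal
        (mul_nonneg c.coe_nonneg (hnonneg _ h))]
      simp only [f, Set.indicator_of_mem h']
    · have h' : φ (w - u) ∉ Q := h
      rw [pairWeight, if_neg h]
      simp only [f, Set.indicator_of_notMem h']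
  have h := hΦ.lintegral_voidPairCount hR hg hRg hB
  refine ⟨h.1, h.2.trans ?_⟩
  rw [← lintegral_map hf φ.continuous.measurable, hc, lintegral_smul_measure, smul_eq_mul,
    lintegral_indicator hQ, ← ENNReal.ofReal_coe_nnreal,
    lintegral_quadrant_exp_neg (NNReal.coe_pos.2 hc0) hq hhom hpos]

lemma IsUnitPoissonProcess.lintegral_voidPairCount_forwardTriangle
    (hΦ : IsUnitPoissonProcess P Φ) (φ : ℂ ≃L[ℝ] ℝ × ℝ) {B : Set ℂ} (hB : MeasurableSet B) :
    AEMeasurable (fun ω => voidPairCount φ (forwardTriangle φ) B Set.univ (Φ ω)) P ∧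
      ∫⁻ ω, voidPairCount φ (forwardTriangle φ) B Set.univ (Φ ω) ∂P = volume B := by
  obtain ⟨c, hc0, hc⟩ := exists_map_volume_eq_smul φ
  have h := hΦ.lintegral_voidPairCount_of_volume_eq hc0 hc (isStableRegion_forwardTriangle φ)
    (q := fun x => (x.1 + x.2) ^ 2 / 2) (by fun_prop) (fun x t => by ring)
    (fun t ht => by positivity) (fun z _ => by positivity)
    (fun u w h => volume_forwardTriangle hc h) hB
  rwa [lintegral_Ioi_inv_one_add_sq, mul_one] at h

lemma IsUnitPoissonProcess.lintegral_voidPairCount_backwardTriangle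
    (hΦ : IsUnitPoissonProcess P Φ) (φ : ℂ ≃L[ℝ] ℝ × ℝ) {B : Set ℂ} (hB : MeasurableSet B) :
    AEMeasurable (fun ω => voidPairCount φ (backwardTriangle φ) B Set.univ (Φ ω)) P ∧
      ∫⁻ ω, voidPairCount φ (backwardTriangle φ) B Set.univ (Φ ω) ∂P = volume B := by
  obtain ⟨c, hc0, hc⟩ := exists_map_volume_eq_smul φ
  have h := hΦ.lintegral_voidPairCount_of_volume_eq hc0 hc (isStableRegion_backwardTriangle φ)
    (q := fun x => (x.1 + x.2) ^ 2 / 2) (by fun_prop) (fun x t => by ring)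
    (fun t ht => by positivity) (fun z _ => by positivity)
    (fun u w h => volume_backwardTriangle hc h) hB
  rwa [lintegral_Ioi_inv_one_add_sq, mul_one] at h

lemma IsUnitPoissonProcess.lintegral_voidPairCount_union
    (hΦ : IsUnitPoissonProcess P Φ) (φ : ℂ ≃L[ℝ] ℝ × ℝ) {B : Set ℂ} (hB : MeasurableSet B) :
    AEMeasurable (fun ω => voidPairCount φ
        (fun u w => forwardTriangle φ u w ∪ backwardTriangle φ u w) B Set.univ (Φ ω)) P ∧
      ∫⁻ ω, voidPairCount φ
        (fun u w => forwardTriangle φ u w ∪ backwardTriangle φ u w) B Set.univ (Φ ω) ∂P =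
        volume B * ENNReal.ofReal (Real.pi * √3 / 9) := by
  obtain ⟨c, hc0, hc⟩ := exists_map_volume_eq_smul φ
  have h := hΦ.lintegral_voidPairCount_of_volume_eq hc0 hc
    ((isStableRegion_forwardTriangle φ).union (isStableRegion_backwardTriangle φ))
    (q := fun x => (x.1 + x.2) ^ 2 - x.1 * x.2) (by fun_prop) (fun x t => by ring)
    (fun t ht => by nlinarith) (fun z hz => by nlinarith [hz.1, hz.2, mul_nonneg hz.1.le hz.2])
    (fun u w h => volume_forwardTriangle_union_backwardTriangle hc h) hB
  rwa [lintegral_Ioi_inv_one_add_add_sq] at h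

end PoissonCounts

/-! ### The cones of the `θ_k`-graph -/

lemma ofReal_add_ofReal_mul_exp {δ : ℝ} (hδ : Real.sin δ ≠ 0) (z : ℂ) :
    ((z.re - z.im * Real.cos δ / Real.sin δ : ℝ) : ℂ) +
      ((z.im / Real.sin δ : ℝ) : ℂ) * Complex.exp (δ * Complex.I) = z := by
  apply Complex.ext
  · rw [Complex.add_re, Complex.re_ofReal_mul, Complex.ofReal_re, Complex.exp_ofReal_mul_I_re]
    field_simp
    ring
  · rw [Complex.add_im, Complex.im_ofReal_mul, Complex.ofReal_im, Complex.exp_ofReal_mul_I_im]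
    field_simp
    ring

/-- The linear coordinates with respect to the two unit vectors at the angles `α` and `α + δ`,
computed after a rotation by `-α`. -/
noncomputable def coneCoords (α δ : ℝ) (hδ : Real.sin δ ≠ 0) : ℂ ≃L[ℝ] ℝ × ℝ :=
  LinearEquiv.toContinuousLinearEquiv
    { toFun := fun z =>
        ((z * Complex.exp (-(α * Complex.I))).re -
            (z * Complex.exp (-(α * Complex.I))).im * Real.cos δ / Real.sin δ,
          (z * Complex.exp (-(α * Complex.I))).im / Real.sin δ)
      map_add' := fun x y => by
        ext
        · simp only [add_mul, Complex.add_re, Complex.add_im, Prod.fst_add]; ring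
        · simp only [add_mul, Complex.add_im, Prod.snd_add]; ring
      map_smul' := fun r x => by
        ext
        · simp only [smul_mul_assoc, Complex.smul_re, Complex.smul_im, Prod.smul_fst,
            smul_eq_mul, RingHom.id_apply]; ring
        · simp only [smul_mul_assoc, Complex.smul_im, Prod.smul_snd, smul_eq_mul,
            RingHom.id_apply]; ring
      invFun := fun x => (x.1 + x.2 * Complex.exp (δ * Complex.I)) * Complex.exp (α * Complex.I)
      left_inv := fun z => by
        have h : z = (z * Complex.exp (-(α * Complex.I))) * Complex.exp (α * Complex.I) := by
          rw [mul_assoc, ← Complex.exp_add, neg_add_cancel, Complex.exp_zero, mul_one]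
        conv_rhs => rw [h]
        exact congrArg (· * Complex.exp (α * Complex.I)) (ofReal_add_ofReal_mul_exp hδ _)
      right_inv := fun x => by
        have h : (x.1 + x.2 * Complex.exp (δ * Complex.I)) * Complex.exp (α * Complex.I) *
            Complex.exp (-(α * Complex.I)) = x.1 + x.2 * Complex.exp (δ * Complex.I) := by
          rw [mul_assoc, ← Complex.exp_add, add_neg_cancel, Complex.exp_zero, mul_one]
        simp only [h]
        ext <;> simp [Complex.exp_ofReal_mul_I_re, Complex.exp_ofReal_mul_I_im] <;> field_simp
        ring }

lemma coneCoords_apply {α δ : ℝ} (hδ : Real.sin δ ≠ 0) (z : ℂ) :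
    coneCoords α δ hδ z = ((z * Complex.exp (-(α * Complex.I))).re -
            (z * Complex.exp (-(α * Complex.I))).im * Real.cos δ / Real.sin δ,
          (z * Complex.exp (-(α * Complex.I))).im / Real.sin δ) := rfl

/-- The coordinates of the point with polar angle `α + ψ`, by the law of sines. -/
lemma coneCoords_polar {α δ : ℝ} (hδ : Real.sin δ ≠ 0) (r ψ : ℝ) :
    coneCoords α δ hδ (r * Complex.exp (((α + ψ : ℝ) : ℂ) * Complex.I)) =
      (r * Real.sin (δ - ψ) / Real.sin δ, r * Real.sin ψ / Real.sin δ) := by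
  have h : r * Complex.exp (((α + ψ : ℝ) : ℂ) * Complex.I) * Complex.exp (-(α * Complex.I)) =
      r * Complex.exp (ψ * Complex.I) := by
    rw [mul_assoc, ← Complex.exp_add]
    congr 2
    push_cast
    ring
  rw [coneCoords_apply, h, Real.sin_sub]
  ext
  · simp [Complex.exp_ofReal_mul_I_re, Complex.exp_ofReal_mul_I_im]
    field_simp
  · simp [Complex.exp_ofReal_mul_I_re, Complex.exp_ofReal_mul_I_im]

lemma mem_sector_coneCoords_iff {α δ : ℝ} (hδ0 : 0 < δ) (hδ : δ < Real.pi)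
    (hs : Real.sin δ ≠ 0) (z : ℂ) :
    z ∈ sector (coneCoords α δ hs) ↔
      ∃ r > (0 : ℝ), ∃ ψ ∈ Set.Ico 0 δ, z = r * Complex.exp (((α + ψ : ℝ) : ℂ) * Complex.I) := by
  have hsin : 0 < Real.sin δ := Real.sin_pos_of_pos_of_lt_pi hδ0 hδ
  constructor
  · intro hz
    have hz0 : z ≠ 0 := by rintro rfl; exact zero_notMem_sector _ hz
    set ζ := z * Complex.exp (-(α * Complex.I)) with hζ
    have hζ0 : ζ ≠ 0 := mul_ne_zero hz0 (Complex.exp_ne_zero _)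
    have hzr : z = ‖ζ‖ * Complex.exp (((α + ζ.arg : ℝ) : ℂ) * Complex.I) := by
      have : z = ζ * Complex.exp (α * Complex.I) := by
        rw [hζ, mul_assoc, ← Complex.exp_add, neg_add_cancel, Complex.exp_zero, mul_one]
      conv_lhs => rw [this, ← Complex.norm_mul_exp_arg_mul_I ζ]
      rw [mul_assoc, ← Complex.exp_add]
      congr 2
      push_cast
      ring
    have hr : 0 < ‖ζ‖ := norm_pos_iff.2 hζ0
    refine ⟨‖ζ‖, hr, ζ.arg, ⟨?_, ?_⟩, hzr⟩
    · have h2 : 0 ≤ ζ.im / Real.sin δ := hz.2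
      exact Complex.arg_nonneg_iff.2 (by simpa [div_nonneg_iff, hsin.le, hsin.not_ge] using h2)
    · rw [hzr] at hz
      have h1 := hz.1
      rw [coneCoords_polar hs] at h1
      by_contra! hle
      have h3 : Real.sin (δ - ζ.arg) ≤ 0 := Real.sin_nonpos_of_nonpos_of_neg_pi_le
        (by linarith) (by linarith [Complex.arg_le_pi ζ])
      have h4 : ‖ζ‖ * Real.sin (δ - ζ.arg) / Real.sin δ ≤ 0 :=
        div_nonpos_of_nonpos_of_nonneg (mul_nonpos_of_nonneg_of_nonpos hr.le h3) hsin.le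
      exact absurd h1 h4.not_gt
  · rintro ⟨r, hr, ψ, ⟨h0, h1⟩, rfl⟩
    rw [sector, Set.mem_ofPred_eq, coneCoords_polar hs]
    have := Real.sin_pos_of_pos_of_lt_pi (sub_pos.2 h1) (by linarith)
    have := Real.sin_nonneg_of_nonneg_of_le_pi h0 (by linarith)
    constructor <;> positivity

/-- The scalar product with the axis is nonnegative on the cone, as the cone has an angle of at most
`π / 2`; so the absolute value in `thetaHeight` can be dropped. -/
lemma thetaHeight_polar {k : ℕ} (i : Fin k) {r ψ : ℝ} (hr : 0 < r)
    (hψ : ψ ∈ Set.Ico 0 (2 * Real.pi / k)) (hk : 4 ≤ k) :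
    thetaHeight k i (r * Complex.exp (((2 * Real.pi * i / k + ψ : ℝ) : ℂ) * Complex.I)) =
      r * Real.cos (ψ - Real.pi / k) := by
  have hk0 : (0 : ℝ) < k := by positivity
  have hpk : Real.pi / k ≤ Real.pi / 4 := by
    gcongr
    exact_mod_cast hk
  have hpos : 0 ≤ Real.cos (ψ - Real.pi / k) := by
    have h2 : 2 * Real.pi / k = 2 * (Real.pi / k) := by ring
    have := Real.pi_pos
    have hpk0 : 0 < Real.pi / k := by positivity
    refine Real.cos_nonneg_of_neg_pi_div_two_le_of_le ?_ ?_ <;> linarith [hψ.1, hψ.2]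
  have hinner : inner ℝ (thetaAxis k i)
      (r * Complex.exp (((2 * Real.pi * i / k + ψ : ℝ) : ℂ) * Complex.I)) =
      r * Real.cos (ψ - Real.pi / k) := by
    rw [Complex.inner, thetaAxis, ← Complex.exp_conj, mul_assoc, ← Complex.exp_add,
      Complex.re_ofReal_mul]
    congr 1
    have : ((2 * Real.pi * i / k + ψ : ℝ) : ℂ) * Complex.I +
        (starRingEnd ℂ) ((((2 * (i : ℝ) + 1) * Real.pi / k : ℝ) : ℂ) * Complex.I) =
        ((ψ - Real.pi / k : ℝ) : ℂ) * Complex.I := by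
      simp only [map_mul, Complex.conj_ofReal, Complex.conj_I]
      push_cast
      ring
    rw [this, Complex.exp_ofReal_mul_I_re]
  rw [thetaHeight, hinner, abs_of_nonneg (mul_nonneg hr.le hpos)]

/-- Each cone of the `θ_k`-graph is a sector in suitable linear coordinates, and there the height
is proportional to the level. -/
lemma exists_sector_eq_thetaCone {k : ℕ} (hk : 4 ≤ k) (i : Fin k) :
    ∃ φ : ℂ ≃L[ℝ] ℝ × ℝ, sector φ = thetaCone k i ∧
      ∃ m > 0, ∀ z ∈ thetaCone k i, thetaHeight k i z = m * level φ z := by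
  have hk0 : (0 : ℝ) < k := by positivity
  have hpk : Real.pi / k ≤ Real.pi / 4 := by
    gcongr
    exact_mod_cast hk
  have hpk0 : 0 < Real.pi / k := by positivity
  have hpi := Real.pi_pos
  set δ := 2 * Real.pi / k with hδdef
  have hδ2 : δ = 2 * (Real.pi / k) := by ring
  have hδ0 : 0 < δ := by positivity
  have hδ : δ < Real.pi := by linarith
  have hs : Real.sin δ ≠ 0 := (Real.sin_pos_of_pos_of_lt_pi hδ0 hδ).ne'
  have hcone : ∀ z, z ∈ thetaCone k i ↔ ∃ r > (0 : ℝ), ∃ ψ ∈ Set.Ico 0 δ,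
      z = r * Complex.exp (((2 * Real.pi * i / k + ψ : ℝ) : ℂ) * Complex.I) := by
    intro z
    have hsum : 2 * Real.pi * ((i : ℝ) + 1) / k = 2 * Real.pi * i / k + δ := by
      rw [hδdef]; ring
    constructor
    · rintro ⟨r, hr, θ, ⟨h1, h2⟩, rfl⟩
      exact ⟨r, hr, θ - 2 * Real.pi * i / k, ⟨by linarith, by linarith⟩, by
        rw [add_sub_cancel]⟩
    · rintro ⟨r, hr, ψ, ⟨h1, h2⟩, rfl⟩
      exact ⟨r, hr, 2 * Real.pi * i / k + ψ, ⟨by linarith, by linarith⟩, rfl⟩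
  refine ⟨coneCoords (2 * Real.pi * i / k) δ hs, ?_, Real.cos (Real.pi / k), ?_, ?_⟩
  · ext z
    rw [mem_sector_coneCoords_iff hδ0 hδ, hcone]
  · exact Real.cos_pos_of_mem_Ioo ⟨by linarith, by linarith⟩
  · intro z hz
    obtain ⟨r, hr, ψ, hψ, rfl⟩ := (hcone z).1 hz
    rw [thetaHeight_polar i hr hψ hk, level_apply, coneCoords_polar hs, hδ2, Real.cos_sub,
      Real.sin_sub, Real.sin_two_mul, Real.cos_two_mul]
    have hsp : Real.sin (Real.pi / k) ≠ 0 :=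
      (Real.sin_pos_of_pos_of_lt_pi hpk0 (by linarith)).ne'
    have hcp : Real.cos (Real.pi / k) ≠ 0 :=
      (Real.cos_pos_of_mem_Ioo ⟨by linarith, by linarith⟩).ne'
    have hsq := Real.sin_sq_add_cos_sq (Real.pi / k)
    field_simp
    linear_combination (2 * Real.sin ψ) * hsq

lemma exists_mem_thetaCone {k : ℕ} (hk : 0 < k) {z : ℂ} (hz : z ≠ 0) :
    ∃ i : Fin k, z ∈ thetaCone k i := by
  have hk0 : (0 : ℝ) < k := by exact_mod_cast hk
  have hpi := Real.pi_pos
  obtain ⟨θ, hθ0, hθ1, hzθ⟩ : ∃ θ : ℝ, 0 ≤ θ ∧ θ < 2 * Real.pi ∧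
      z = ‖z‖ * Complex.exp (θ * Complex.I) := by
    rcases le_or_gt 0 z.arg with h | h
    · exact ⟨z.arg, h, by linarith [Complex.arg_le_pi z], (Complex.norm_mul_exp_arg_mul_I z).symm⟩
    · refine ⟨z.arg + 2 * Real.pi, by linarith [Complex.neg_pi_lt_arg z], by linarith, ?_⟩
      push_cast
      rw [add_mul, Complex.exp_add, Complex.exp_two_pi_mul_I, mul_one,
        Complex.norm_mul_exp_arg_mul_I]
  have hx0 : 0 ≤ θ * k / (2 * Real.pi) := by positivity
  have hx1 : θ * k / (2 * Real.pi) < k := by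
    rw [div_lt_iff₀ (by positivity)]
    nlinarith
  refine ⟨⟨⌊θ * k / (2 * Real.pi)⌋₊, (Nat.floor_lt hx0).2 hx1⟩, ‖z‖, norm_pos_iff.2 hz, θ,
    ⟨?_, ?_⟩, hzθ⟩
  · have := Nat.floor_le hx0
    rw [le_div_iff₀ (by positivity)] at this
    rw [div_le_iff₀ hk0]
    linarith
  · have := Nat.lt_floor_add_one (θ * k / (2 * Real.pi))
    rw [div_lt_iff₀ (by positivity)] at this
    rw [lt_div_iff₀ hk0]
    linarith

/-- The cones of the `θ_k`-graph are pairwise disjoint. -/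
lemma eq_of_mem_thetaCone {k : ℕ} {i j : Fin k} {z : ℂ} (hi : z ∈ thetaCone k i)
    (hj : z ∈ thetaCone k j) : i = j := by
  have hk : 0 < k := i.pos
  have hk0 : (0 : ℝ) < k := by exact_mod_cast hk
  have hpi := Real.pi_pos
  obtain ⟨r, hr, θ, hθ, rfl⟩ := hi
  obtain ⟨r', hr', θ', hθ', h⟩ := hj
  -- both angles lie in `[0, 2π)`
  have hbound : ∀ (l : Fin k) (t : ℝ), t ∈ Set.Ico (2 * Real.pi * (l : ℝ) / k)
      (2 * Real.pi * ((l : ℝ) + 1) / k) → 0 ≤ t ∧ t < 2 * Real.pi := by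
    intro l t ht
    have hl : (l : ℝ) + 1 ≤ k := by exact_mod_cast l.2
    refine ⟨le_trans (by positivity) ht.1, ht.2.trans_le ?_⟩
    rw [div_le_iff₀ hk0]
    gcongr
  have hrr : r = r' := by
    have := congrArg norm h
    simpa [Complex.norm_exp_ofReal_mul_I, abs_of_pos hr, abs_of_pos hr'] using this
  subst hrr
  have hexp := mul_left_cancel₀ (Complex.ofReal_ne_zero.2 hr.ne') h
  have hθθ : θ = θ' := by
    obtain ⟨n, hn⟩ := Complex.exp_eq_exp_iff_exists_int.1 hexp
    have hn' : θ = θ' + n * (2 * Real.pi) := by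
      have := congrArg Complex.im hn
      simpa using this
    obtain ⟨h1, h2⟩ := hbound i θ hθ
    obtain ⟨h3, h4⟩ := hbound j θ' hθ'
    have hn1 : (n : ℝ) < 1 := by nlinarith
    have hn2 : (-1 : ℝ) < n := by nlinarith
    have hn0 : n = 0 := by
      have h5 : n < 1 := by exact_mod_cast hn1
      have h6 : -1 < n := by exact_mod_cast hn2
      omega
    simpa [hn0] using hn'
  subst hθθ
  have hlt : ∀ l l' : Fin k, 2 * Real.pi * (l : ℝ) / k ≤ θ →
      θ < 2 * Real.pi * ((l' : ℝ) + 1) / k → (l : ℕ) ≤ l' := by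
    intro l l' h1 h2
    have h3 := h1.trans_lt h2
    rw [div_lt_div_iff_of_pos_right hk0, mul_lt_mul_iff_right₀ (by positivity)] at h3
    exact Nat.lt_succ_iff.1 (by exact_mod_cast h3)
  exact Fin.ext (le_antisymm (hlt i j hθ.1 hθ'.2) (hlt j i hθ'.1 hθ.2))

/-- The cone whose index is larger by `k / 2` is the opposite cone. -/
lemma mem_thetaCone_iff_neg_mem {k m : ℕ} (hkm : k = m + m) {i j : Fin k}
    (hij : (j : ℕ) = i + m) (z : ℂ) : z ∈ thetaCone k j ↔ -z ∈ thetaCone k i := by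
  have hk0 : (k : ℝ) ≠ 0 := by exact_mod_cast i.pos.ne'
  have hkm' : (k : ℝ) = m + m := by exact_mod_cast hkm
  have hij' : (j : ℝ) = i + m := by exact_mod_cast hij
  have h1 : 2 * Real.pi * (j : ℝ) / k = 2 * Real.pi * i / k + Real.pi := by
    rw [hij']; field_simp; linarith
  have h2 : 2 * Real.pi * ((j : ℝ) + 1) / k = 2 * Real.pi * (i + 1) / k + Real.pi := by
    rw [hij']; field_simp; linarith
  constructor
  · rintro ⟨r, hr, θ, ⟨h3, h4⟩, rfl⟩
    refine ⟨r, hr, θ - Real.pi, ⟨by linarith, by linarith⟩, ?_⟩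
    push_cast
    rw [sub_mul, Complex.exp_sub, Complex.exp_pi_mul_I]
    ring
  · rintro ⟨r, hr, θ, ⟨h3, h4⟩, hz⟩
    refine ⟨r, hr, θ + Real.pi, ⟨by linarith, by linarith⟩, ?_⟩
    push_cast
    rw [add_mul, Complex.exp_add, Complex.exp_pi_mul_I, ← neg_neg z, hz]
    ring

lemma thetaAxis_eq_neg {k m : ℕ} (hkm : k = m + m) {i j : Fin k} (hij : (j : ℕ) = i + m) :
    thetaAxis k j = -thetaAxis k i := by
  have hk0 : (k : ℝ) ≠ 0 := by exact_mod_cast i.pos.ne'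
  have hkm' : (k : ℝ) = m + m := by exact_mod_cast hkm
  have hij' : (j : ℝ) = i + m := by exact_mod_cast hij
  have h1 : (2 * (j : ℝ) + 1) * Real.pi / k = (2 * (i : ℝ) + 1) * Real.pi / k + Real.pi := by
    rw [hij']; field_simp; linarith
  rw [thetaAxis, thetaAxis, h1]
  push_cast
  rw [add_mul, Complex.exp_add, Complex.exp_pi_mul_I]
  ring

/-- For even `k` the cones come in opposite pairs. -/
lemma exists_opposite_thetaCone {k : ℕ} (hk : Even k) (i : Fin k) :
    ∃ j : Fin k, (∀ z, z ∈ thetaCone k j ↔ -z ∈ thetaCone k i) ∧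
      ∀ z, thetaHeight k j z = thetaHeight k i z := by
  obtain ⟨m, hm⟩ := hk
  rcases lt_or_ge (i : ℕ) m with h | h
  · refine ⟨⟨i + m, by omega⟩, mem_thetaCone_iff_neg_mem hm rfl, fun z => ?_⟩
    rw [thetaHeight, thetaAxis_eq_neg hm (i := i) rfl, inner_neg_left, abs_neg, thetaHeight]
  · have hj : (i : ℕ) = (⟨i - m, by omega⟩ : Fin k) + m := by simp [h]
    refine ⟨⟨i - m, by omega⟩, fun z => ?_, fun z => ?_⟩
    · rw [mem_thetaCone_iff_neg_mem hm hj, neg_neg]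
    · conv_rhs => rw [thetaHeight, thetaAxis_eq_neg hm hj, inner_neg_left, abs_neg]
      rw [thetaHeight]

/-! ### Counting edges by void triangles -/

section Graph

variable {k : ℕ} {S : Set ℂ} {i : Fin k} {φ : ℂ ≃L[ℝ] ℝ × ℝ} {m : ℝ}

/-- A point chooses `w` in a cone exactly if no point lies in the cone strictly below `w`. Ties are
allowed on both sides. -/
lemma chooses_iff (hsec : sector φ = thetaCone k i) (hm : 0 < m)
    (hh : ∀ z ∈ thetaCone k i, thetaHeight k i z = m * level φ z) (u w : ℂ) :
    Chooses k S u i w ↔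
      u ∈ S ∧ w ∈ S ∧ w - u ∈ sector φ ∧ S ∩ forwardTriangle φ u w = ∅ := by
  rw [Chooses, hsec]
  refine and_congr_right fun _ => and_congr_right fun _ => and_congr_right fun hwu => ?_
  rw [Set.eq_empty_iff_forall_notMem]
  refine forall_congr' fun v => ?_
  simp only [forwardTriangle, Set.mem_inter_iff, Set.mem_ofPred_eq, not_and, not_lt, hsec]
  refine forall_congr' fun _ => forall_congr' fun hv => ?_
  rw [hh _ hwu, hh _ hv, mul_le_mul_iff_right₀ hm]

/-- If `w` lies in the `i`-th cone of `u` and `k` is even, then `u` lies in the opposite cone of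
`w`, and only in this cone can `w` choose `u`. -/
lemma exists_chooses_iff (hk : Even k) (hsec : sector φ = thetaCone k i) (hm : 0 < m)
    (hh : ∀ z ∈ thetaCone k i, thetaHeight k i z = m * level φ z) {u w : ℂ} (hu : u ∈ S)
    (hw : w ∈ S) (hwu : w - u ∈ sector φ) :
    (∃ j : Fin k, Chooses k S w j u) ↔ S ∩ backwardTriangle φ u w = ∅ := by
  obtain ⟨j, hj, hhj⟩ := exists_opposite_thetaCone hk i
  have huj : u - w ∈ thetaCone k j := by rwa [hj, neg_sub, ← hsec]
  have hheight : ∀ v, w - v ∈ thetaCone k i → thetaHeight k j (v - w) = m * level φ (w - v) := by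
    intro v hv
    rw [hhj, ← hh _ hv, ← neg_sub w v]
    simp only [thetaHeight, inner_neg_right, abs_neg]
  have key : Chooses k S w j u ↔ S ∩ backwardTriangle φ u w = ∅ := by
    rw [Chooses, Set.eq_empty_iff_forall_notMem]
    simp only [hw, hu, huj, true_and]
    refine forall_congr' fun v => ?_
    simp only [backwardTriangle, Set.mem_inter_iff, Set.mem_ofPred_eq, not_and, not_lt, hsec]
    refine forall_congr' fun _ => ?_
    rw [hj, neg_sub]
    refine forall_congr' fun hv => ?_
    rw [hheight u (hsec ▸ hwu), hheight v hv, mul_le_mul_iff_right₀ hm]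
  rw [← key]
  refine ⟨?_, fun h => ⟨j, h⟩⟩
  rintro ⟨j', hj'⟩
  rwa [eq_of_mem_thetaCone huj hj'.2.2.1]

/-- In general position a point chooses at most one point in each cone. -/
lemma Chooses.eq (hgen : S.Pairwise (InGeneralPosition φ)) (hm : 0 < m)
    (hh : ∀ z ∈ thetaCone k i, thetaHeight k i z = m * level φ z) {u w w' : ℂ}
    (h : Chooses k S u i w) (h' : Chooses k S u i w') : w = w' := by
  by_contra hne
  obtain ⟨_, hw, hwu, hmin⟩ := h
  obtain ⟨_, hw', hwu', hmin'⟩ := h'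
  have heq := le_antisymm (hmin w' hw' hwu') (hmin' w hw hwu)
  rw [hh _ hwu, hh _ hwu'] at heq
  have h1 := mul_left_cancel₀ hm.ne' heq
  refine (hgen hw hw' hne).2.2 ?_
  rw [← sub_sub_sub_cancel_right w w' u, map_sub, h1, sub_self]

lemma chosenCount_eq (hgen : S.Pairwise (InGeneralPosition φ))
    (hsec : sector φ = thetaCone k i) (hm : 0 < m)
    (hh : ∀ z ∈ thetaCone k i, thetaHeight k i z = m * level φ z) (B : Set ℂ) :
    chosenCount k i B S = voidPairCount φ (forwardTriangle φ) B Set.univ S := by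
  have hset : {p : ℂ × ℂ | p.1 ∈ S ∩ B ∧ p.2 ∈ S ∩ Set.univ ∧ p.2 - p.1 ∈ sector φ ∧
      S ∩ forwardTriangle φ p.1 p.2 = ∅} = {p | p.1 ∈ B ∧ Chooses k S p.1 i p.2} := by
    ext p
    simp only [Set.mem_ofPred_eq, chooses_iff hsec hm hh, Set.mem_inter_iff, Set.mem_univ]
    tauto
  have himg : {u : ℂ | u ∈ B ∧ ∃ w, Chooses k S u i w} =
      Prod.fst '' {p : ℂ × ℂ | p.1 ∈ B ∧ Chooses k S p.1 i p.2} := by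
    ext u
    simp
  rw [chosenCount, voidPairCount, hset, himg, Set.InjOn.encard_image]
  rintro ⟨u, w⟩ ⟨_, h⟩ ⟨u', w'⟩ ⟨_, h'⟩ (rfl : u = u')
  exact Prod.ext rfl (h.eq hgen hm hh h')

lemma mutualCount_eq (hk : Even k) (hgen : S.Pairwise (InGeneralPosition φ))
    (hsec : sector φ = thetaCone k i) (hm : 0 < m)
    (hh : ∀ z ∈ thetaCone k i, thetaHeight k i z = m * level φ z) (B : Set ℂ) :
    mutualCount k i B S =
      voidPairCount φ (fun u w => forwardTriangle φ u w ∪ backwardTriangle φ u w) B Set.univ S := by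
  have hset : {p : ℂ × ℂ | p.1 ∈ S ∩ B ∧ p.2 ∈ S ∩ Set.univ ∧ p.2 - p.1 ∈ sector φ ∧
      S ∩ (forwardTriangle φ p.1 p.2 ∪ backwardTriangle φ p.1 p.2) = ∅} =
      {p | p.1 ∈ B ∧ Chooses k S p.1 i p.2 ∧ ∃ j : Fin k, Chooses k S p.2 j p.1} := by
    ext p
    simp only [Set.mem_ofPred_eq, Set.mem_inter_iff, Set.mem_univ, and_true,
      Set.inter_union_distrib_left, Set.union_empty_iff]
    constructor
    · rintro ⟨⟨h1, h2⟩, h3, h4, h5, h6⟩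
      exact ⟨h2, (chooses_iff hsec hm hh _ _).2 ⟨h1, h3, h4, h5⟩,
        (exists_chooses_iff hk hsec hm hh h1 h3 h4).2 h6⟩
    · rintro ⟨h1, h2, h3⟩
      obtain ⟨h4, h5, h6, h7⟩ := (chooses_iff hsec hm hh _ _).1 h2
      exact ⟨⟨h4, h1⟩, h5, h6, h7, (exists_chooses_iff hk hsec hm hh h4 h5 h6).1 h3⟩
  have himg : {u : ℂ | u ∈ B ∧ ∃ w, Chooses k S u i w ∧ ∃ j : Fin k, Chooses k S w j u} =
      Prod.fst '' {p : ℂ × ℂ | p.1 ∈ B ∧ Chooses k S p.1 i p.2 ∧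
        ∃ j : Fin k, Chooses k S p.2 j p.1} := by
    ext u
    simp
  rw [mutualCount, voidPairCount, hset, himg, Set.InjOn.encard_image]
  rintro ⟨u, w⟩ ⟨_, h, _⟩ ⟨u', w'⟩ ⟨_, h', _⟩ (rfl : u = u')
  exact Prod.ext rfl (h.eq hgen hm hh h')

end Graph

lemma toENNReal_encard_iUnion_of_pairwise_disjoint {X ι : Type*} [Fintype ι] {s : ι → Set X}
    (hs : Pairwise (Function.onFun Disjoint s)) :
    ((⋃ n, s n).encard : ℝ≥0∞) = ∑ n, ((s n).encard : ℝ≥0∞) := by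
  let _ : MeasurableSpace X := ⊤
  have h : ∀ t : Set X, (t.encard : ℝ≥0∞) = Measure.count t := fun t =>
    (Measure.count_apply MeasurableSpace.measurableSet_top).symm
  simp only [h]
  rw [measure_iUnion hs fun _ => MeasurableSpace.measurableSet_top, tsum_fintype]

/-- The degree sum counts the ordered pairs of adjacent points with first point in `B`. -/
lemma degreeSum_eq_encard (k : ℕ) (B S : Set ℂ) :
    degreeSum k B S = ({p : ℂ × ℂ | p.1 ∈ S ∩ B ∧ p.2 ∈ S ∧ p.1 ≠ p.2 ∧
      ((∃ i : Fin k, Chooses k S p.1 i p.2) ∨ ∃ i : Fin k, Chooses k S p.2 i p.1)}.encard :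
        ℝ≥0∞) := by
  unfold degreeSum
  simp only [← ENNReal.tsum_set_one]
  rw [← ENNReal.tsum_sigma' (fun _ => (1 : ℝ≥0∞))]
  have hadj : ∀ u w : S, w ∈ (thetaGraph k S).neighborSet u ↔ (u : ℂ) ≠ w ∧
      ((∃ i : Fin k, Chooses k S u i w) ∨ ∃ i : Fin k, Chooses k S w i u) := by
    intro u w
    rw [SimpleGraph.mem_neighborSet, thetaGraph, SimpleGraph.fromRel_adj, Ne, Subtype.ext_iff]
  let e : (Σ u : {u : S // (u : ℂ) ∈ B}, (thetaGraph k S).neighborSet u.1) ≃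
      {p : ℂ × ℂ | p.1 ∈ S ∩ B ∧ p.2 ∈ S ∧ p.1 ≠ p.2 ∧
        ((∃ i : Fin k, Chooses k S p.1 i p.2) ∨ ∃ i : Fin k, Chooses k S p.2 i p.1)} :=
    { toFun := fun x => ⟨(x.1.1, x.2.1), ⟨x.1.1.2, x.1.2⟩, x.2.1.2, (hadj _ _).1 x.2.2⟩
      invFun := fun p => ⟨⟨⟨p.1.1, p.2.1.1⟩, p.2.1.2⟩, ⟨⟨p.1.2, p.2.2.1⟩, (hadj _ _).2 p.2.2.2⟩⟩
      left_inv := fun _ => rfl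
      right_inv := fun _ => rfl }
  exact e.tsum_eq fun _ => (1 : ℝ≥0∞)

/-- For every ordered pair of adjacent points, the second one lies in exactly one cone of the first
one, and at least one of the two triangles of the pair is void; both are void if the edge is
mutual. Adding the pairs for which both are void therefore counts the two kinds separately. -/
lemma degreeSum_add_sum_eq {k : ℕ} (hk : Even k) {S : Set ℂ} {φ : Fin k → ℂ ≃L[ℝ] ℝ × ℝ}
    {m : Fin k → ℝ} (hsec : ∀ i, sector (φ i) = thetaCone k i) (hm : ∀ i, 0 < m i)
    (hh : ∀ i, ∀ z ∈ thetaCone k i, thetaHeight k i z = m i * level (φ i) z) (B : Set ℂ) :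
    degreeSum k B S + ∑ i, voidPairCount (φ i)
        (fun u w => forwardTriangle (φ i) u w ∪ backwardTriangle (φ i) u w) B Set.univ S =
      ∑ i, voidPairCount (φ i) (forwardTriangle (φ i)) B Set.univ S +
        ∑ i, voidPairCount (φ i) (backwardTriangle (φ i)) B Set.univ S := by
  set F : Fin k → Set (ℂ × ℂ) := fun i => {p | p.1 ∈ S ∩ B ∧ p.2 ∈ S ∩ Set.univ ∧
    p.2 - p.1 ∈ sector (φ i) ∧ S ∩ forwardTriangle (φ i) p.1 p.2 = ∅} with hF
  set G : Fin k → Set (ℂ × ℂ) := fun i => {p | p.1 ∈ S ∩ B ∧ p.2 ∈ S ∩ Set.univ ∧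
    p.2 - p.1 ∈ sector (φ i) ∧ S ∩ backwardTriangle (φ i) p.1 p.2 = ∅} with hG
  have hinter : ∀ i, voidPairCount (φ i)
      (fun u w => forwardTriangle (φ i) u w ∪ backwardTriangle (φ i) u w) B Set.univ S =
      ((F i ∩ G i).encard : ℝ≥0∞) := by
    intro i
    rw [voidPairCount]
    congr 2
    ext p
    simp only [hF, hG, Set.mem_ofPred_eq, Set.inter_union_distrib_left, Set.union_empty_iff,
      Set.mem_inter_iff]
    tauto
  have hunion : degreeSum k B S = ∑ i, ((F i ∪ G i).encard : ℝ≥0∞) := by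
    rw [degreeSum_eq_encard, ← toENNReal_encard_iUnion_of_pairwise_disjoint]
    · congr 2
      ext ⟨u, w⟩
      simp only [Set.mem_ofPred_eq, Set.mem_iUnion, Set.mem_union, hF, hG]
      constructor
      · rintro ⟨hu, hw, hne, h⟩
        have hk0 : 0 < k := by rcases h with ⟨j, _⟩ | ⟨j, _⟩ <;> exact j.pos
        obtain ⟨i, hi⟩ := exists_mem_thetaCone hk0 (sub_ne_zero.2 hne.symm)
        have hi' : w - u ∈ sector (φ i) := hsec i ▸ hi
        refine ⟨i, h.imp ?_ ?_⟩
        · rintro ⟨j, hj⟩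
          obtain rfl := eq_of_mem_thetaCone hi hj.2.2.1
          exact ⟨hu, ⟨hw, trivial⟩, hi', ((chooses_iff (hsec i) (hm i) (hh i) u w).1 hj).2.2.2⟩
        · intro hj
          exact ⟨hu, ⟨hw, trivial⟩, hi',
            (exists_chooses_iff hk (hsec i) (hm i) (hh i) hu.1 hw hi').1 hj⟩
      · rintro ⟨i, h⟩
        have hne : ∀ {u w : ℂ}, w - u ∈ sector (φ i) → u ≠ w := by
          rintro u w h rfl
          exact zero_notMem_sector (φ i) (by simpa using h)
        rcases h with ⟨hu, ⟨hw, -⟩, hi, h⟩ | ⟨hu, ⟨hw, -⟩, hi, h⟩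
        · exact ⟨hu, hw, hne hi, Or.inl ⟨i, (chooses_iff (hsec i) (hm i) (hh i) u w).2
            ⟨hu.1, hw, hi, h⟩⟩⟩
        · exact ⟨hu, hw, hne hi, Or.inr
            ((exists_chooses_iff hk (hsec i) (hm i) (hh i) hu.1 hw hi).2 h)⟩
    · intro i j hij
      rw [Function.onFun, Set.disjoint_left]
      rintro p hi hj
      have h1 : p.2 - p.1 ∈ sector (φ i) := hi.elim (fun h => h.2.2.1) fun h => h.2.2.1
      have h2 : p.2 - p.1 ∈ sector (φ j) := hj.elim (fun h => h.2.2.1) fun h => h.2.2.1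
      rw [hsec] at h1 h2
      exact hij (eq_of_mem_thetaCone h1 h2)
  rw [hunion, Finset.sum_congr rfl fun i _ => hinter i, ← Finset.sum_add_distrib,
    ← Finset.sum_add_distrib]
  refine Finset.sum_congr rfl fun i _ => ?_
  have := congrArg ENat.toENNReal (Set.encard_union_add_encard_inter (F i) (G i))
  rwa [ENat.toENNReal_add, ENat.toENNReal_add] at this

/-! ### Mutual edges and degrees -/

theorem mainTheorem1 {Ω : Type*} [MeasurableSpace Ω] (P : Measure Ω) [IsProbabilityMeasure P]
    (Φ : Ω → Set ℂ) (hΦ : IsUnitPoissonProcess P Φ)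
    (k : ℕ) (hk : Even k) (hk4 : 4 ≤ k)
    (B : Set ℂ) (hB : MeasurableSet B) (hB0 : volume B ≠ 0) (hB1 : volume B ≠ ∞) :
    -- the counts are random variables (up to null sets), so that the expectations make sense
    (∀ i : Fin k, AEMeasurable (fun ω => chosenCount k i B (Φ ω)) P ∧
      AEMeasurable (fun ω => mutualCount k i B (Φ ω)) P) ∧
    AEMeasurable (fun ω => degreeSum k B (Φ ω)) P ∧
    -- the probability that a chosen edge is mutual, in each single cone and overall
    (∀ i : Fin k, coneMutualProb P Φ k i B = ENNReal.ofReal (Real.pi * √3 / 9)) ∧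
    mutualProb P Φ k B = ENNReal.ofReal (Real.pi * √3 / 9) ∧
    -- the average degree
    averageDegree P Φ k B = ENNReal.ofReal ((2 - Real.pi * √3 / 9) * k) := by
  choose φ hsec m hm hh using exists_sector_eq_thetaCone hk4
  have hgen : ∀ᵐ ω ∂P, ∀ i, (Φ ω).Pairwise (InGeneralPosition (φ i)) :=
    ae_all_iff.2 fun i => hΦ.ae_pairwise_inGeneralPosition (φ i)
  have hF := fun i => hΦ.lintegral_voidPairCount_forwardTriangle (φ i) hB
  have hG := fun i => hΦ.lintegral_voidPairCount_backwardTriangle (φ i) hB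
  have hU := fun i => hΦ.lintegral_voidPairCount_union (φ i) hB
  have hcF : ∀ i, (fun ω => chosenCount k i B (Φ ω)) =ᵐ[P]
      fun ω => voidPairCount (φ i) (forwardTriangle (φ i)) B Set.univ (Φ ω) := fun i =>
    hgen.mono fun ω hω => chosenCount_eq (hω i) (hsec i) (hm i) (hh i) B
  have hcU : ∀ i, (fun ω => mutualCount k i B (Φ ω)) =ᵐ[P] fun ω => voidPairCount (φ i)
      (fun u w => forwardTriangle (φ i) u w ∪ backwardTriangle (φ i) u w) B Set.univ (Φ ω) :=
    fun i => hgen.mono fun ω hω => mutualCount_eq hk (hω i) (hsec i) (hm i) (hh i) B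
  have hmF : ∀ i, AEMeasurable (fun ω => chosenCount k i B (Φ ω)) P :=
    fun i => (hF i).1.congr (hcF i).symm
  have hmU : ∀ i, AEMeasurable (fun ω => mutualCount k i B (Φ ω)) P :=
    fun i => (hU i).1.congr (hcU i).symm
  have hiF : ∀ i, ∫⁻ ω, chosenCount k i B (Φ ω) ∂P = volume B :=
    fun i => (lintegral_congr_ae (hcF i)).trans (hF i).2
  have hiU : ∀ i, ∫⁻ ω, mutualCount k i B (Φ ω) ∂P =
      volume B * ENNReal.ofReal (Real.pi * √3 / 9) :=
    fun i => (lintegral_congr_ae (hcU i)).trans (hU i).2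
  have hk0 : (k : ℝ≥0∞) ≠ 0 := by exact_mod_cast (by omega : k ≠ 0)
  have hkt : (k : ℝ≥0∞) ≠ ∞ := ENNReal.natCast_ne_top k
  have hmUs : AEMeasurable (fun ω => ∑ i, voidPairCount (φ i)
      (fun u w => forwardTriangle (φ i) u w ∪ backwardTriangle (φ i) u w) B Set.univ (Φ ω)) P :=
    Finset.aemeasurable_fun_sum _ fun i _ => (hU i).1
  have hmFs : AEMeasurable (fun ω => ∑ i,
      voidPairCount (φ i) (forwardTriangle (φ i)) B Set.univ (Φ ω)) P :=
    Finset.aemeasurable_fun_sum _ fun i _ => (hF i).1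
  have hmGs : AEMeasurable (fun ω => ∑ i,
      voidPairCount (φ i) (backwardTriangle (φ i)) B Set.univ (Φ ω)) P :=
    Finset.aemeasurable_fun_sum _ fun i _ => (hG i).1
  have hiUs : ∫⁻ ω, ∑ i, voidPairCount (φ i)
      (fun u w => forwardTriangle (φ i) u w ∪ backwardTriangle (φ i) u w) B Set.univ (Φ ω) ∂P =
      k * (volume B * ENNReal.ofReal (Real.pi * √3 / 9)) := by
    rw [lintegral_finsetSum' _ fun i _ => (hU i).1, Finset.sum_congr rfl fun i _ => (hU i).2]
    simp
  have hiUs_ne : k * (volume B * ENNReal.ofReal (Real.pi * √3 / 9)) ≠ ∞ :=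
    ENNReal.mul_ne_top hkt (ENNReal.mul_ne_top hB1 ENNReal.ofReal_ne_top)
  -- almost surely the number of mutual edges is finite, so that it can be subtracted
  have hdeg : (fun ω => degreeSum k B (Φ ω)) =ᵐ[P] fun ω =>
      ∑ i, voidPairCount (φ i) (forwardTriangle (φ i)) B Set.univ (Φ ω) +
        ∑ i, voidPairCount (φ i) (backwardTriangle (φ i)) B Set.univ (Φ ω) -
        ∑ i, voidPairCount (φ i)
          (fun u w => forwardTriangle (φ i) u w ∪ backwardTriangle (φ i) u w) B Set.univ (Φ ω) := by
    filter_upwards [ae_lt_top' hmUs (hiUs ▸ hiUs_ne)] with ω hω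
    exact ENNReal.eq_sub_of_add_eq hω.ne (degreeSum_add_sum_eq hk hsec hm hh B)
  have hmD : AEMeasurable (fun ω => degreeSum k B (Φ ω)) P :=
    ((hmFs.add hmGs).sub hmUs).congr hdeg.symm
  refine ⟨fun i => ⟨hmF i, hmU i⟩, hmD, fun i => ?_, ?_, ?_⟩
  · rw [coneMutualProb, hiF, hiU, mul_comm, ENNReal.mul_div_cancel_right hB0 hB1]
  · rw [mutualProb, lintegral_finsetSum' _ fun i _ => hmU i,
      lintegral_finsetSum' _ fun i _ => hmF i,
      Finset.sum_congr rfl fun i _ => hiU i, Finset.sum_congr rfl fun i _ => hiF i]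
    simp only [Finset.sum_const, Finset.card_univ, Fintype.card_fin, nsmul_eq_mul]
    rw [← mul_assoc, mul_comm, ENNReal.mul_div_cancel_right (mul_ne_zero hk0 hB0)
      (ENNReal.mul_ne_top hkt hB1)]
  · have hsum : ∫⁻ ω, degreeSum k B (Φ ω) ∂P +
        k * (volume B * ENNReal.ofReal (Real.pi * √3 / 9)) = k * volume B + k * volume B := by
      rw [← hiUs, ← lintegral_add_left' hmD]
      simp only [degreeSum_add_sum_eq hk hsec hm hh B]
      rw [lintegral_add_left' hmFs, lintegral_finsetSum' _ fun i _ => (hF i).1,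
        lintegral_finsetSum' _ fun i _ => (hG i).1, Finset.sum_congr rfl fun i _ => (hF i).2,
        Finset.sum_congr rfl fun i _ => (hG i).2]
      simp
    rw [averageDegree, hΦ.lintegral_encard hB hB1, ENNReal.eq_sub_of_add_eq hiUs_ne hsum]
    refine ((ENNReal.eq_div_iff hB0 hB1).2 ?_).symm
    set b := (volume B).toReal
    have hb : volume B = ENNReal.ofReal b := (ENNReal.ofReal_toReal hB1).symm
    have hb0 : 0 ≤ b := ENNReal.toReal_nonneg
    have hk' : (0 : ℝ) ≤ k := Nat.cast_nonneg k
    rw [hb, ← ENNReal.ofReal_natCast]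
    simp only [← ENNReal.ofReal_mul hb0, ← ENNReal.ofReal_mul hk']
    rw [← ENNReal.ofReal_add (by positivity) (by positivity),
      ← ENNReal.ofReal_sub _ (by positivity)]
    congr 1
    ring
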